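/- **Conventions.** For a finite alphabet $\Gamma$ and a word $w\in\Gamma^*$ let $\exp(w)$ be the greatest $e\in\mathbb N$ such that $w=up^ev$ for words $u,p,v$ with $p$ nonempty, and for $L\subseteq\Gamma^*$ let $\exp(L)=\sup\{\exp(w)\mid w\in L\}\in\mathbb N\cup\{\infty\}$ (both read as $0$ when there is nothing to maximize over). Call $L$ *periodically nice* if $\exp(L)=\infty$ holds exactly when $L$ is infinite, and *periodically perfect* if for every $n\in\mathbb N$ there is $N\in\mathbb N$ such that every $w\in L$ of length at least $N$ satisfies $\exp(w)\ge n$. Let $\pi:\Gamma^*\to M$ be an epimorphism onto a monoid $M$ and $\mathrm{nf}:M\to\Gamma^*$ a normal form, i.e. $\pi(\mathrm{nf}(x))=x$ for all $x\in M$. The pair $(\pi,\mathrm{nf})$ is *admissible* (resp. *perfectly admissible*) if for all $u,p,v\in M$ the language $\mathrm{nf}(up^*v)=\{\mathrm{nf}(up^nv)\mid n\in\mathbb N\}$ is periodically nice (resp. periodically perfect). For a set $A$ with an irreflexive symmetric relation $I_A$ let $M(A,I_A)=A^*/\{ab=ba\mid (a,b)\in I_A\}$ be the trace monoid. If $A$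 is linearly ordered, $\mathrm{nf}_{\mathrm{lex}}:M(A,I_A)\to A^*$ maps a trace to the lexicographically first word representing it. **Setting.** Let $J$ be a finite linearly ordered set with an irreflexive symmetric relation $I\subseteq J\times J$. For each $i\in J$ let $M_i$ be a monoid, $\Gamma_i$ a finite linearly ordered alphabet, $\pi_i:\Gamma_i^*\to M_i$ an epimorphism, and $\mathrm{nf}_i:M_i\to\Gamma_i^*$ a normal form with respect to $\pi_i$. Let $$\mathbb M=\Big(\ast_{i\in J}M_i\Big)\Big/\{xy=yx\mid x\in M_j,\ y\in M_k,\ (j,k)\in I\}$$ be the graph product. Let $\Gamma=\bigsqcup_{i\in J}\Gamma_i$ and $\Sigma=\bigsqcup_{i\in J}(M_i\setminus\{1\})$; a letter coming from index $i$ has color $i$, and two letters are independent iff their colors are related by $I$ (we write $I$ again for these relations). Order $\Gamma$ linearly by comparing colors in $J$ first and letters of the same color $i$ in $\Gamma_i$. Let $\pi:\Gamma^*\to\mathbb M$ be the epimorphism induced by the $\pi_i$ and $\psi:M(\Sigma,I)\to\mathbb M$ the canonical epimorphism. A trace in $M(\Sigma,I)$ is *reduced* if it has no factor $ab$ with letters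 $a,b\in\Sigma$ of the same color; every $x\in\mathbb M$ has a unique reduced trace representation $\mathrm{nf}_\Sigma(x)=x_1\cdots x_m$, that is, a reduced trace with $\psi(\mathrm{nf}_\Sigma(x))=x$. Writing $c_k$ for the color of $x_k$, define $$\mathrm{nf}_{\mathbb M}(x)=\mathrm{nf}_{\mathrm{lex}}\big(\mathrm{nf}_{c_1}(x_1)\cdots\mathrm{nf}_{c_m}(x_m)\big)\in\Gamma^*,$$ where the product is taken in $M(\Gamma,I)$. **Theorem.** If all pairs $(\pi_i,\mathrm{nf}_i)$, $i\in J$, are admissible, then $(\pi,\mathrm{nf}_{\mathbb M})$ is admissible (in particular $\mathrm{nf}_{\mathbb M}$ is a normal form with respect to $\pi$). If all pairs $(\pi_i,\mathrm{nf}_i)$ are perfectly admissible, then $(\pi,\mathrm{nf}_{\mathbb M})$ is perfectly admissible. -/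

import Mathlib

namespace GraphProd

noncomputable section

/-! ### Exponent of periodicity -/

/-- The exponent of periodicity of a word: the greatest `e` such that the word factors as
`u * p ^ e * v` with `p` nonempty (and `0` if the alphabet is empty, when no such `p` exists).
The set is bounded by the length of the word, so `sSup` is its maximum. -/
def expWord {A : Type*} (w : FreeMonoid A) : ℕ :=
  sSup {e : ℕ | ∃ u p v : FreeMonoid A, p ≠ 1 ∧ w = u * p ^ e * v}

/-- The exponent of periodicity of a language, as a value in `ℕ ∪ {∞}`. -/
def expLang {A : Type*} (L : Set (FreeMonoid A)) : ℕ∞ :=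
  ⨆ w ∈ L, (expWord w : ℕ∞)

/-- A language is periodically nice if its exponent of periodicity is infinite exactly when the
language is infinite. -/
def PeriodicallyNice {A : Type*} (L : Set (FreeMonoid A)) : Prop :=
  expLang L = ⊤ ↔ L.Infinite

/-- A language is periodically perfect if all its long words have high exponent of periodicity. -/
def PeriodicallyPerfect {A : Type*} (L : Set (FreeMonoid A)) : Prop :=
  ∀ n : ℕ, ∃ N : ℕ, ∀ w ∈ L, N ≤ w.length → n ≤ expWord w

/-! ### Normal forms -/

/-- `nf` is a normal form with respect to `π`, that is, a section of `π`
(in particular `π` is then surjective). -/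
def IsNormalForm {A M : Type*} [Monoid M] (π : FreeMonoid A →* M) (nf : M → FreeMonoid A) : Prop :=
  ∀ x, π (nf x) = x

/-- The set `u p^* v = {u p^n v | n ∈ ℕ}`. -/
def starSet {M : Type*} [Monoid M] (u p v : M) : Set M :=
  Set.range fun n : ℕ => u * p ^ n * v

/-- The pair `(π, nf)` consists of an epimorphism and a normal form with respect to it, and the
language `nf (u p^* v)` is periodically nice for all `u, p, v`. -/
def IsAdmissible {A M : Type*} [Monoid M] (π : FreeMonoid A →* M) (nf : M → FreeMonoid A) : Prop :=
  IsNormalForm π nf ∧ ∀ u p v : M, PeriodicallyNice (nf '' starSet u p v)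

/-- The pair `(π, nf)` consists of an epimorphism and a normal form with respect to it, and the
language `nf (u p^* v)` is periodically perfect for all `u, p, v`. -/
def IsPerfectlyAdmissible {A M : Type*} [Monoid M] (π : FreeMonoid A →* M)
    (nf : M → FreeMonoid A) : Prop :=
  IsNormalForm π nf ∧ ∀ u p v : M, PeriodicallyPerfect (nf '' starSet u p v)

/-! ### Trace monoids

An independence alphabet (a set of letters with an irreflexive symmetric relation) is a
`SimpleGraph`. -/

/-- The defining relations `ab = ba`, for independent letters `a, b`, of a trace monoid. -/
def traceRel {A : Type*} (I : SimpleGraph A) (x y : FreeMonoid A) : Prop :=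
  ∃ a b : A, I.Adj a b ∧ x = FreeMonoid.of a * FreeMonoid.of b ∧
    y = FreeMonoid.of b * FreeMonoid.of a

/-- The trace monoid (free partially commutative monoid) `M(A, I)`. -/
abbrev TraceMonoid {A : Type*} (I : SimpleGraph A) : Type _ := (conGen (traceRel I)).Quotient

/-- The canonical epimorphism from the free monoid onto the trace monoid. -/
def toTrace {A : Type*} (I : SimpleGraph A) : FreeMonoid A →* TraceMonoid I :=
  (conGen (traceRel I)).mk'

/-- The universal property of the trace monoid. -/
def traceLift {A N : Type*} [Monoid N] (I : SimpleGraph A) (f : A → N)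
    (hf : ∀ a b, I.Adj a b → f a * f b = f b * f a) : TraceMonoid I →* N :=
  (conGen (traceRel I)).lift (FreeMonoid.lift f) <| Con.conGen_le.2 <| by
    rintro _ _ ⟨a, b, hab, rfl, rfl⟩
    simpa [Con.ker_rel] using hf a b hab

theorem traceLift_toTrace {A N : Type*} [Monoid N] (I : SimpleGraph A) (f : A → N)
    (hf : ∀ a b, I.Adj a b → f a * f b = f b * f a) (w : FreeMonoid A) :
    traceLift I f hf (toTrace I w) = FreeMonoid.lift f w := rfl

theorem toTrace_surjective {A : Type*} (I : SimpleGraph A) : Function.Surjective (toTrace I) :=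
  Con.mk'_surjective

theorem toTrace_comm {A : Type*} (I : SimpleGraph A) {a b : A} (h : I.Adj a b) :
    toTrace I (.of a) * toTrace I (.of b) = toTrace I (.of b) * toTrace I (.of a) :=
  (Con.eq _).2 (ConGen.Rel.of _ _ ⟨a, b, h, rfl, rfl⟩)

/-- Words representing the same trace are permutations of each other. -/
theorem perm_of_toTrace_eq {A : Type*} (I : SimpleGraph A) {w w' : FreeMonoid A}
    (h : toTrace I w = toTrace I w') : w.toList.Perm w'.toList := by
  have key : ∀ l : FreeMonoid A,
      FreeMonoid.lift (fun a => Multiplicative.ofAdd ({a} : Multiset A)) l =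
        Multiplicative.ofAdd (l.toList : Multiset A) := by
    intro l
    induction l using FreeMonoid.inductionOn' with
    | one => rfl
    | of_mul a l ih =>
      rw [map_mul, ih, FreeMonoid.lift_eval_of, ← ofAdd_add]
      rfl
  have h2 := congrArg (traceLift I (fun a => Multiplicative.ofAdd ({a} : Multiset A))
    (fun a b _ => mul_comm _ _)) h
  rw [traceLift_toTrace, traceLift_toTrace, key, key] at h2
  exact Multiset.coe_eq_coe.1 (Multiplicative.ofAdd.injective h2)

/-- `w` is the first word, in the lexicographic order of words induced by the order `r` of the
letters, among all words that represent the trace `x`. -/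
def IsLexFirst {A : Type*} (I : SimpleGraph A) (r : A → A → Prop) (x : TraceMonoid I)
    (w : FreeMonoid A) : Prop :=
  toTrace I w = x ∧
    ∀ w' : FreeMonoid A, toTrace I w' = x → w' = w ∨ List.Lex r w.toList w'.toList

theorem exists_isLexFirst {A : Type*} (I : SimpleGraph A) (r : A → A → Prop)
    [IsStrictTotalOrder A r] (x : TraceMonoid I) : ∃ w, IsLexFirst I r x w := by
  classical
  let _ : LinearOrder A := linearOrderOfSTO r
  obtain ⟨w₀, hw₀⟩ := toTrace_surjective I x
  let S : Set (List A) := {l | toTrace I (FreeMonoid.ofList l) = x}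
  have hS : S.Finite := by
    refine (List.finite_toSet w₀.toList.permutations).subset fun l hl => ?_
    have := perm_of_toTrace_eq I (w := FreeMonoid.ofList l) (w' := w₀) (hl.trans hw₀.symm)
    exact List.mem_permutations.2 this
  obtain ⟨l, hl, hmin⟩ := Set.exists_min_image S id hS ⟨w₀.toList, hw₀⟩
  refine ⟨FreeMonoid.ofList l, hl, fun w' hw' => ?_⟩
  rcases (hmin w'.toList hw').eq_or_lt with h | h
  · exact Or.inl h.symm
  · exact Or.inr h

/-- The lexicographic normal form of traces, for the strict linear order `r` of the letters. -/
def nfLex {A : Type*} (I : SimpleGraph A) (r : A → A → Prop) [IsStrictTotalOrder A r]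
    (x : TraceMonoid I) : FreeMonoid A :=
  (exists_isLexFirst I r x).choose

theorem nfLex_spec {A : Type*} (I : SimpleGraph A) (r : A → A → Prop) [IsStrictTotalOrder A r]
    (x : TraceMonoid I) : IsLexFirst I r x (nfLex I r x) :=
  (exists_isLexFirst I r x).choose_spec

/-! ### Graph products

Throughout, `I` is the independence relation on the set `J` of colors. A letter of a disjoint
union `Σ i, X i` has its index as its color, and `I.comap Sigma.fst` is the induced independence
relation on letters: two letters are independent iff their colors are. -/

/-- The defining relations of the graph product: elements of local monoids of independent colors
commute. -/
def graphProdRel {J : Type*} (I : SimpleGraph J) (M : J → Type*) [∀ i, Monoid (M i)]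
    (a b : Monoid.CoprodI M) : Prop :=
  ∃ (j k : J) (x : M j) (y : M k), I.Adj j k ∧
    a = Monoid.CoprodI.of x * Monoid.CoprodI.of y ∧ b = Monoid.CoprodI.of y * Monoid.CoprodI.of x

/-- The graph product of the local monoids `M i`, as a quotient of their free product. -/
abbrev GraphProduct {J : Type*} (I : SimpleGraph J) (M : J → Type*) [∀ i, Monoid (M i)] : Type _ :=
  (conGen (graphProdRel I M)).Quotient

/-- The canonical homomorphism from a local monoid to the graph product. -/
def ofLocal {J : Type*} (I : SimpleGraph J) (M : J → Type*) [∀ i, Monoid (M i)] (i : J) :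
    M i →* GraphProduct I M :=
  (conGen (graphProdRel I M)).mk'.comp Monoid.CoprodI.of

theorem ofLocal_comm {J : Type*} (I : SimpleGraph J) (M : J → Type*) [∀ i, Monoid (M i)]
    {j k : J} (h : I.Adj j k) (x : M j) (y : M k) :
    ofLocal I M j x * ofLocal I M k y = ofLocal I M k y * ofLocal I M j x :=
  (Con.eq _).2 (ConGen.Rel.of _ _ ⟨j, k, x, y, h, rfl, rfl⟩)

/-- The epimorphism `π` from the free monoid over the disjoint union of the local alphabets onto
the graph product, induced by the local epimorphisms. -/
def globalPi {J : Type*} (I : SimpleGraph J) (M : J → Type*) [∀ i, Monoid (M i)] {Γ : J → Type*}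
    (π : ∀ i, FreeMonoid (Γ i) →* M i) : FreeMonoid (Σ i, Γ i) →* GraphProduct I M :=
  FreeMonoid.lift fun a => ofLocal I M a.1 (π a.1 (FreeMonoid.of a.2))

/-- The alphabet of all nontrivial elements of the local monoids. -/
abbrev BigLetter {J : Type*} (M : J → Type*) [∀ i, Monoid (M i)] : Type _ :=
  Σ i, {x : M i // x ≠ 1}

/-- The canonical homomorphism `ψ` from the trace monoid over the nontrivial elements of the local
monoids to the graph product. -/
def psi {J : Type*} (I : SimpleGraph J) (M : J → Type*) [∀ i, Monoid (M i)] :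
    TraceMonoid (I.comap (Sigma.fst : BigLetter M → J)) →* GraphProduct I M :=
  traceLift _ (fun a => ofLocal I M a.1 a.2.1) fun _ _ h => ofLocal_comm I M h _ _

/-- A trace is reduced if it has no factor consisting of two letters of the same color. -/
def IsReduced {J : Type*} (I : SimpleGraph J) (M : J → Type*) [∀ i, Monoid (M i)]
    (u : TraceMonoid (I.comap (Sigma.fst : BigLetter M → J))) : Prop :=
  ∀ (a b : BigLetter M) (s t : TraceMonoid (I.comap (Sigma.fst : BigLetter M → J))),
    u = s * toTrace _ (FreeMonoid.of a) * toTrace _ (FreeMonoid.of b) * t → a.1 ≠ b.1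

theorem psi_surjective {J : Type*} (I : SimpleGraph J) (M : J → Type*) [∀ i, Monoid (M i)] :
    Function.Surjective (psi I M) := by
  classical
  have hof : ∀ (i : J) (x : M i), ∃ u, psi I M u = ofLocal I M i x := by
    intro i x
    by_cases hx : x = 1
    · exact ⟨1, by rw [map_one, hx, map_one]⟩
    · exact ⟨toTrace _ (FreeMonoid.of ⟨i, x, hx⟩), by rw [psi, traceLift_toTrace]; rfl⟩
  intro y
  obtain ⟨z, rfl⟩ := Con.mk'_surjective y
  induction z using Monoid.CoprodI.induction_on with
  | one => exact ⟨1, by simp only [map_one]⟩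
  | of i x => exact hof i x
  | mul a b ha hb =>
    obtain ⟨u, hu⟩ := ha
    obtain ⟨v, hv⟩ := hb
    exact ⟨u * v, by rw [map_mul, map_mul, hu, hv]⟩

theorem exists_reduced {J : Type*} (I : SimpleGraph J) (M : J → Type*) [∀ i, Monoid (M i)]
    (x : GraphProduct I M) : ∃ u, IsReduced I M u ∧ psi I M u = x := by
  classical
  let T := I.comap (Sigma.fst : BigLetter M → J)
  -- a shortest word that represents `x` yields a reduced trace
  have hex : ∃ n : ℕ, ∃ w : FreeMonoid (BigLetter M), w.length = n ∧ psi I M (toTrace T w) = x := by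
    obtain ⟨u, hu⟩ := psi_surjective I M x
    obtain ⟨w, rfl⟩ := toTrace_surjective _ u
    exact ⟨_, w, rfl, hu⟩
  obtain ⟨w, hwn, hwx⟩ := Nat.find_spec hex
  refine ⟨toTrace T w, ?_, hwx⟩
  rintro ⟨i, a, ha⟩ ⟨j, b, hb⟩ s t hst hij
  obtain rfl : i = j := hij
  obtain ⟨s, rfl⟩ := toTrace_surjective _ s
  obtain ⟨t, rfl⟩ := toTrace_surjective _ t
  have hlen : w.length = s.length + 2 + t.length := by
    simp only [← map_mul] at hst
    have := (perm_of_toTrace_eq _ hst).length_eq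
    simp only [FreeMonoid.toList_mul, FreeMonoid.toList_of, List.length_append,
      List.length_singleton] at this
    simp only [FreeMonoid.length]
    omega
  rw [hst] at hwx
  have hab : psi I M (toTrace T s) * ofLocal I M i (a * b) * psi I M (toTrace T t) = x := by
    rw [← hwx, map_mul, map_mul, map_mul, map_mul, ← mul_assoc (psi I M (toTrace T s))]
    rfl
  by_cases h1 : a * b = 1
  · refine Nat.find_min hex (m := (s * t).length) ?_ ⟨s * t, rfl, ?_⟩
    · rw [← hwn, hlen, FreeMonoid.length_mul]; omega
    · rw [← hab, h1, map_one, mul_one, map_mul, map_mul]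
  · let c : BigLetter M := ⟨i, a * b, h1⟩
    refine Nat.find_min hex (m := (s * FreeMonoid.of c * t).length) ?_
      ⟨s * FreeMonoid.of c * t, rfl, ?_⟩
    · rw [← hwn, hlen, FreeMonoid.length_mul, FreeMonoid.length_mul, FreeMonoid.length_of]; omega
    · rw [← hab, map_mul, map_mul, map_mul, map_mul]
      rfl

/-- The reduced trace representation of an element of the graph product (it is unique). -/
def nfBig {J : Type*} (I : SimpleGraph J) (M : J → Type*) [∀ i, Monoid (M i)]
    (x : GraphProduct I M) : TraceMonoid (I.comap (Sigma.fst : BigLetter M → J)) :=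
  (exists_reduced I M x).choose

theorem nfBig_spec {J : Type*} (I : SimpleGraph J) (M : J → Type*) [∀ i, Monoid (M i)]
    (x : GraphProduct I M) : IsReduced I M (nfBig I M x) ∧ psi I M (nfBig I M x) = x :=
  (exists_reduced I M x).choose_spec

/-- A word over the local alphabet of color `i`, viewed as a trace over the disjoint union of all
local alphabets. -/
def localTrace {J : Type*} (I : SimpleGraph J) (Γ : J → Type*) (i : J) :
    FreeMonoid (Γ i) →* TraceMonoid (I.comap (Sigma.fst : (Σ i, Γ i) → J)) :=
  (toTrace _).comp (FreeMonoid.map (Sigma.mk i))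

theorem localTrace_comm {J : Type*} (I : SimpleGraph J) (Γ : J → Type*) {j k : J}
    (h : I.Adj j k) (x : FreeMonoid (Γ j)) (y : FreeMonoid (Γ k)) :
    localTrace I Γ j x * localTrace I Γ k y = localTrace I Γ k y * localTrace I Γ j x := by
  change Commute _ _
  induction x using FreeMonoid.inductionOn' with
  | one => rw [map_one]; exact Commute.one_left _
  | of_mul a x ih =>
    rw [map_mul]
    refine Commute.mul_left ?_ ih
    clear ih
    induction y using FreeMonoid.inductionOn' with
    | one => rw [map_one]; exact Commute.one_right _
    | of_mul b y ih =>
      rw [map_mul]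
      refine Commute.mul_right ?_ ih
      exact toTrace_comm (I.comap (Sigma.fst : (Σ i, Γ i) → J)) (a := ⟨j, a⟩) (b := ⟨k, b⟩) h

/-- The substitution of local normal forms for the letters of a trace. -/
def substNF {J : Type*} (I : SimpleGraph J) (M : J → Type*) [∀ i, Monoid (M i)] {Γ : J → Type*}
    (nf : ∀ i, M i → FreeMonoid (Γ i)) :
    TraceMonoid (I.comap (Sigma.fst : BigLetter M → J)) →*
      TraceMonoid (I.comap (Sigma.fst : (Σ i, Γ i) → J)) :=
  traceLift _ (fun a => localTrace I Γ a.1 (nf a.1 a.2.1)) fun _ _ h => localTrace_comm I Γ h _ _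

/-- The strict order on the disjoint union of the local alphabets: letters are compared by their
colors first, and letters of the same color are compared in their local alphabet. -/
def letterLT {J : Type*} [LinearOrder J] (Γ : J → Type*) [∀ i, LinearOrder (Γ i)] :
    (Σ i, Γ i) → (Σ i, Γ i) → Prop :=
  Sigma.Lex (· < ·) fun _ => (· < ·)

instance {J : Type*} [LinearOrder J] (Γ : J → Type*) [∀ i, LinearOrder (Γ i)] :
    IsStrictTotalOrder (Σ i, Γ i) (letterLT Γ) where
  toTrichotomous := inferInstanceAs (Std.Trichotomous (Sigma.Lex (· < ·) fun _ => (· < ·)))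
  toIsStrictOrder :=
    { toIrrefl := inferInstanceAs (Std.Irrefl (Sigma.Lex (· < ·) fun _ => (· < ·)))
      toIsTrans := inferInstanceAs (IsTrans _ (Sigma.Lex (· < ·) fun _ => (· < ·))) }

/-- The global normal form of the graph product: take the reduced trace representation,
substitute the local normal forms for its letters, and take the lexicographic normal form. -/
def globalNF {J : Type*} [LinearOrder J] (I : SimpleGraph J) (M : J → Type*) [∀ i, Monoid (M i)]
    {Γ : J → Type*} [∀ i, LinearOrder (Γ i)] (nf : ∀ i, M i → FreeMonoid (Γ i))
    (x : GraphProduct I M) : FreeMonoid (Σ i, Γ i) :=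
  nfLex _ (letterLT Γ) (substNF I M nf (nfBig I M x))

end

end GraphProd

set_option linter.unusedSectionVars false

/-! The normal form can be computed over $\Sigma$. Letters of $\Gamma$ are compared by color first,
and nontrivial elements have nonempty local normal forms. So if a reduced word over the local
elements always continues with the smallest available color, substituting the local normal forms
into it gives the lexicographically first word (`exists_globalNF_eq`). A power inside the word over
$\Sigma$, or a high exponent in the local normal form of one of its letters, therefore reappears in
the global normal form. Since reduced traces are unique (`Reduced.traceEq_of_eval_eq`), any reduced
word for an element may be used to locate such letters and powers.

The sets $u(xy)^*v$ and $ux(yx)^*yv$ differ by at most one element, and inserting one word preserves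
both niceness and perfection. Hence $p$ may be rotated, and `cyclic_induction` reduces to $p=uq$,
where $u$ consists of pairwise independent letters that are also independent of $q$, and all powers
of $q$ are reduced.

If $q$ is nonempty, the exponents tend to infinity with $n$, without any use of the local exponents.
Indeed $u^n$ is a product of a fixed number of local elements, so it and the outer factors change
$q^n$ only within a bounded distance (`NearPower`). The lexicographic normal form of $sq^mt$, with
$s,t$ short, contains high powers (`exists_power_infix`): cut before the letters of the largest
color of $q$, a suitable long factor of it becomes a periodic sequence of blocks.

If $q$ is empty, the elements have the form $s\,\prod_i x_ia_i^ny_i\,t$, and every nontrivial local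
factor survives as a letter of the reduced trace (`exists_evalFamily_decomposition`). The local
hypotheses on $x_ia_i^*y_i$ then supply the exponents. If all local factors range over finite sets,
only finitely many global elements arise. -/

namespace GraphProd

/-! ### Traces as words modulo projections to dependent pairs of colors -/

section Words

variable {J : Type*} [DecidableEq J] {X : J → Type*}

/-- The projection of a word to the letters of two colors. -/
def proj (c d : J) (w : List (Σ i, X i)) : List (Σ i, X i) :=
  w.filter fun a => a.1 = c ∨ a.1 = d

@[simp] theorem proj_append (c d : J) (w v : List (Σ i, X i)) :
    proj c d (w ++ v) = proj c d w ++ proj c d v := List.filter_append ..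

theorem proj_cons_of_mem {c d : J} {a : Σ i, X i} (h : a.1 = c ∨ a.1 = d) (w : List (Σ i, X i)) :
    proj c d (a :: w) = a :: proj c d w := List.filter_cons_of_pos (by simpa using h)

theorem proj_cons_of_not_mem {c d : J} {a : Σ i, X i} (h : ¬(a.1 = c ∨ a.1 = d))
    (w : List (Σ i, X i)) : proj c d (a :: w) = proj c d w :=
  List.filter_cons_of_neg (by simpa using h)

theorem mem_proj {c d : J} {a : Σ i, X i} {w : List (Σ i, X i)} :
    a ∈ proj c d w ↔ a ∈ w ∧ (a.1 = c ∨ a.1 = d) := by simp [proj]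

/-- Two words are trace equivalent if their projections to all pairs of dependent colors agree. -/
def TraceEq (I : SimpleGraph J) (w v : List (Σ i, X i)) : Prop :=
  ∀ c d, ¬ I.Adj c d → proj c d w = proj c d v

variable {I : SimpleGraph J} {w v w' v' : List (Σ i, X i)}

namespace TraceEq

theorem refl (w : List (Σ i, X i)) : TraceEq I w w := fun _ _ _ => rfl

theorem symm (h : TraceEq I w v) : TraceEq I v w := fun c d hc => (h c d hc).symm

theorem trans {u : List (Σ i, X i)} (h : TraceEq I w v) (h' : TraceEq I v u) : TraceEq I w u :=
  fun c d hc => (h c d hc).trans (h' c d hc)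

theorem append (h : TraceEq I w v) (h' : TraceEq I w' v') : TraceEq I (w ++ w') (v ++ v') :=
  fun c d hc => by rw [proj_append, proj_append, h c d hc, h' c d hc]

theorem append_left (u : List (Σ i, X i)) (h : TraceEq I w v) : TraceEq I (u ++ w) (u ++ v) :=
  (refl u).append h

theorem append_right (u : List (Σ i, X i)) (h : TraceEq I w v) : TraceEq I (w ++ u) (v ++ u) :=
  h.append (refl u)

theorem cons (a : Σ i, X i) (h : TraceEq I w v) : TraceEq I (a :: w) (a :: v) :=
  h.append_left [a]

theorem of_append_left {u : List (Σ i, X i)} (h : TraceEq I (u ++ w) (u ++ v)) : TraceEq I w v :=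
  fun c d hc => by simpa using h c d hc

theorem of_cons {a : Σ i, X i} (h : TraceEq I (a :: w) (a :: v)) : TraceEq I w v :=
  of_append_left (u := [a]) h

theorem reverse (h : TraceEq I w v) : TraceEq I w.reverse v.reverse := fun c d hc => by
  have := h c d hc
  unfold proj at *
  rw [List.filter_reverse, List.filter_reverse, this]

theorem filter (h : TraceEq I w v) (p : J → Bool) :
    TraceEq I (w.filter fun a => p a.1) (v.filter fun a => p a.1) := fun c d hc => by
  have := h c d hc
  unfold proj at *
  rw [List.filter_filter, List.filter_filter]
  simp only [Bool.and_comm _ (p _)]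
  rw [← List.filter_filter, ← List.filter_filter, this]

theorem filter_eq (h : TraceEq I w v) (c : J) :
    (w.filter fun a => a.1 = c) = v.filter fun a => a.1 = c := by
  simpa [proj] using h c c (I.loopless.irrefl c)

theorem mem_iff (h : TraceEq I w v) {a : Σ i, X i} : a ∈ w ↔ a ∈ v := by
  have := h.filter_eq a.1
  constructor <;> intro ha
  · have h2 : a ∈ w.filter fun b => b.1 = a.1 := by simpa using ha
    rw [this] at h2; exact (List.mem_filter.1 h2).1
  · have h2 : a ∈ v.filter fun b => b.1 = a.1 := by simpa using ha
    rw [← this] at h2; exact (List.mem_filter.1 h2).1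

theorem count_color (h : TraceEq I w v) (c : J) :
    (w.countP fun a => a.1 = c) = v.countP fun a => a.1 = c := by
  rw [List.countP_eq_length_filter, List.countP_eq_length_filter, h.filter_eq c]

theorem eq_nil (h : TraceEq I [] v) : v = [] :=
  List.eq_nil_iff_forall_not_mem.2 fun _ ha => List.not_mem_nil (h.mem_iff.2 ha)

/-- A letter may be moved over independent letters. -/
theorem move {x : Σ i, X i} {v₁ : List (Σ i, X i)} (h : ∀ z ∈ v₁, I.Adj z.1 x.1)
    (v₂ : List (Σ i, X i)) : TraceEq I (v₁ ++ x :: v₂) (x :: (v₁ ++ v₂)) := fun c d hc => by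
  by_cases hx : x.1 = c ∨ x.1 = d
  · have : proj c d v₁ = [] := by
      rw [List.eq_nil_iff_forall_not_mem]
      intro z hz
      obtain ⟨hz1, hz2⟩ := mem_proj.1 hz
      have := h z hz1
      rcases hx with hx | hx <;> rcases hz2 with hz2 | hz2 <;> rw [hx, hz2] at this
      · exact I.loopless.irrefl _ this
      · exact hc this.symm
      · exact hc this
      · exact I.loopless.irrefl _ this
    rw [proj_append, proj_cons_of_mem hx, proj_cons_of_mem hx, proj_append, this]
    rfl
  · rw [proj_append, proj_cons_of_not_mem hx, proj_cons_of_not_mem hx, proj_append]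

/-- The projection to the color of `x` shows that the first letter of this color in `v` is `x`. A
dependent letter in front of it would come first in the projection to the two colors, where `x` has
to be first. -/
theorem exists_of_cons {x : Σ i, X i} (h : TraceEq I (x :: w) v) :
    ∃ v₁ v₂, v = v₁ ++ x :: v₂ ∧ (∀ z ∈ v₁, I.Adj z.1 x.1) ∧ TraceEq I w (v₁ ++ v₂) := by
  have h1 := h.filter_eq x.1
  rw [List.filter_cons_of_pos (by simp)] at h1
  obtain ⟨v₁, v₂, rfl, hv₁, -, -⟩ := List.filter_eq_cons_iff.1 h1.symm
  have hadj : ∀ z ∈ v₁, I.Adj z.1 x.1 := by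
    intro z hz
    by_contra hn
    have h2 := h _ _ hn
    rw [proj_append, proj_cons_of_mem (Or.inr rfl)] at h2
    have hzm : z ∈ proj z.1 x.1 v₁ := mem_proj.2 ⟨hz, Or.inl rfl⟩
    cases hp : proj z.1 x.1 v₁ with
    | nil => rw [hp] at hzm; simp at hzm
    | cons y l =>
      rw [hp, List.cons_append] at h2
      have hy : x ∈ proj z.1 x.1 v₁ := by rw [hp, (List.cons.inj h2).1]; simp
      simpa using hv₁ x (mem_proj.1 hy).1
  exact ⟨v₁, v₂, rfl, hadj, (h.trans (move hadj v₂)).of_cons⟩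

theorem move_last {x : Σ i, X i} {v₂ : List (Σ i, X i)} (h : ∀ z ∈ v₂, I.Adj z.1 x.1)
    (v₁ : List (Σ i, X i)) : TraceEq I (v₁ ++ x :: v₂) (v₁ ++ v₂ ++ [x]) := by
  have := (move (I := I) (x := x) (v₁ := v₂.reverse) (by simpa using h) v₁.reverse).reverse
  simpa using this

theorem exists_of_concat {x : Σ i, X i} (h : TraceEq I (w ++ [x]) v) :
    ∃ v₁ v₂, v = v₁ ++ x :: v₂ ∧ (∀ z ∈ v₂, I.Adj z.1 x.1) ∧ TraceEq I w (v₁ ++ v₂) := by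
  have := h.reverse
  rw [List.reverse_append, List.reverse_singleton, List.singleton_append] at this
  obtain ⟨v₁, v₂, h1, h2, h3⟩ := this.exists_of_cons
  refine ⟨v₂.reverse, v₁.reverse, ?_, by simpa using h2, by simpa using h3.reverse⟩
  rw [← List.reverse_inj]; simpa using h1

theorem length_eq (h : TraceEq I w v) : w.length = v.length := by
  induction w generalizing v with
  | nil => rw [h.eq_nil]
  | cons x w ih =>
    obtain ⟨v₁, v₂, rfl, -, h3⟩ := h.exists_of_cons
    have := ih h3
    simp only [List.length_append, List.length_cons] at *
    omega

/-- Independent words commute. -/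
theorem comm (h : ∀ a ∈ w, ∀ b ∈ v, I.Adj a.1 b.1) : TraceEq I (w ++ v) (v ++ w) := by
  induction v generalizing w with
  | nil => simpa using refl w
  | cons x v ih =>
    exact (move (fun z hz => h z hz x (by simp)) v).trans
      ((ih fun a ha b hb => h a ha b (by simp [hb])).cons x)

end TraceEq

/-- The first letter of `w` stands in `v` behind independent letters only, so the defining relations
move it to the front. -/
theorem toTrace_eq_of_traceEq (h : TraceEq I w v) :
    toTrace (I.comap Sigma.fst) (FreeMonoid.ofList w) =
      toTrace (I.comap Sigma.fst) (FreeMonoid.ofList v) := by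
  induction w generalizing v with
  | nil => rw [h.eq_nil]
  | cons x w ih =>
    obtain ⟨v₁, v₂, rfl, h2, h3⟩ := h.exists_of_cons
    rw [FreeMonoid.ofList_cons, map_mul, ih h3]
    clear h h3
    induction v₁ with
    | nil => rfl
    | cons z v₁ ih =>
      rw [List.cons_append, List.cons_append, FreeMonoid.ofList_cons, FreeMonoid.ofList_cons,
        map_mul, map_mul, ← ih fun z hz => h2 z (by simp [hz]), ← mul_assoc, ← mul_assoc,
        toTrace_comm]
      exact (h2 z (by simp)).symm

/-- Erasing all letters outside two dependent colors is a homomorphism to the free monoid. It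
respects the commutations, since of two independent letters at least one is erased. -/
theorem traceEq_of_toTrace_eq {w v : FreeMonoid (Σ i, X i)}
    (h : toTrace (I.comap Sigma.fst) w = toTrace (I.comap Sigma.fst) v) :
    TraceEq I w.toList v.toList := by
  intro c d hcd
  let f : (Σ i, X i) → FreeMonoid (Σ i, X i) :=
    fun a => if a.1 = c ∨ a.1 = d then FreeMonoid.of a else 1
  have hf : ∀ a b : Σ i, X i, (I.comap Sigma.fst).Adj a b → f a * f b = f b * f a := by
    intro a b hab
    have hab : I.Adj a.1 b.1 := hab
    simp only [f]
    split_ifs with ha hb <;> try simp only [one_mul, mul_one]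
    rcases ha with ha | ha <;> rcases hb with hb | hb <;> rw [ha, hb] at hab
    · exact absurd hab (I.loopless.irrefl _)
    · exact absurd hab hcd
    · exact absurd hab.symm hcd
    · exact absurd hab (I.loopless.irrefl _)
  have key : ∀ l : FreeMonoid (Σ i, X i),
      (FreeMonoid.lift f l).toList = proj c d l.toList := by
    intro l
    induction l using FreeMonoid.inductionOn' with
    | one => rfl
    | of_mul a l ih =>
      rw [map_mul, FreeMonoid.lift_eval_of, FreeMonoid.toList_mul, FreeMonoid.toList_of_mul, ih]
      by_cases ha : a.1 = c ∨ a.1 = d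
      · rw [proj_cons_of_mem ha]; simp [f, ha]
      · rw [proj_cons_of_not_mem ha]; simp [f, ha]
  have h2 := congrArg (traceLift _ f hf) h
  rw [traceLift_toTrace, traceLift_toTrace] at h2
  rw [← key, ← key, h2]

/-- Some letter of color `c` can be moved to the front of the word. -/
def Avail (I : SimpleGraph J) (c : J) : List (Σ i, X i) → Prop
  | [] => False
  | a :: w => a.1 = c ∨ I.Adj a.1 c ∧ Avail I c w

theorem avail_iff {c : J} : Avail I c w ↔
    ∃ w₁ y w₂, w = w₁ ++ y :: w₂ ∧ y.1 = c ∧ ∀ z ∈ w₁, I.Adj z.1 c := by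
  induction w with
  | nil => simp [Avail]
  | cons a w ih =>
    rw [Avail, ih]
    constructor
    · rintro (h | ⟨h, w₁, y, w₂, rfl, h2, h3⟩)
      · exact ⟨[], a, w, rfl, h, by simp⟩
      · exact ⟨a :: w₁, y, w₂, rfl, h2, by simpa using ⟨h, h3⟩⟩
    · rintro ⟨w₁, y, w₂, h1, h2, h3⟩
      cases w₁ with
      | nil => left; rw [List.nil_append] at h1; rw [(List.cons.inj h1).1, h2]
      | cons z w₁ =>
        rw [List.cons_append] at h1
        obtain ⟨rfl, rfl⟩ := List.cons.inj h1
        exact Or.inr ⟨h3 _ (by simp), w₁, y, w₂, rfl, h2, fun z hz => h3 z (by simp [hz])⟩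

theorem Avail.exists_traceEq_cons {c : J} (h : Avail I c w) :
    ∃ (x : X c) (v : List (Σ i, X i)), TraceEq I w (⟨c, x⟩ :: v) := by
  obtain ⟨w₁, ⟨c, x⟩, w₂, rfl, rfl, h⟩ := avail_iff.1 h
  exact ⟨x, w₁ ++ w₂, TraceEq.move h w₂⟩

theorem avail_of_traceEq_cons {x : Σ i, X i} (h : TraceEq I w (x :: v)) : Avail I x.1 w := by
  obtain ⟨v₁, v₂, h1, h2, -⟩ := h.symm.exists_of_cons
  exact avail_iff.2 ⟨v₁, x, v₂, h1, rfl, h2⟩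

theorem Avail.congr {c : J} (h : Avail I c w) (hv : TraceEq I w v) : Avail I c v := by
  obtain ⟨x, u, hu⟩ := h.exists_traceEq_cons
  exact avail_of_traceEq_cons (hv.symm.trans hu)

theorem Avail.exists_mem {c : J} (h : Avail I c w) : ∃ a ∈ w, a.1 = c := by
  obtain ⟨w₁, y, w₂, rfl, h1, -⟩ := avail_iff.1 h
  exact ⟨y, by simp, h1⟩

theorem Avail.append {c : J} (h : Avail I c w) (v : List (Σ i, X i)) : Avail I c (w ++ v) := by
  obtain ⟨w₁, y, w₂, rfl, h1, h2⟩ := avail_iff.1 h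
  exact avail_iff.2 ⟨w₁, y, w₂ ++ v, by simp, h1, h2⟩

theorem avail_append_iff {c : J} : Avail I c (w ++ v) ↔
    Avail I c w ∨ (∀ z ∈ w, I.Adj z.1 c) ∧ Avail I c v := by
  induction w with
  | nil => simp [Avail]
  | cons a w ih => simp only [List.cons_append, Avail, ih, List.mem_cons, forall_eq_or_imp]; tauto

theorem Avail.of_append {c : J} (h : Avail I c (w ++ v)) (hc : ∃ a ∈ w, a.1 = c) :
    Avail I c w := by
  rcases avail_append_iff.1 h with h | ⟨h, -⟩
  · exact h
  · obtain ⟨a, ha, rfl⟩ := hc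
    exact absurd (h a ha) (I.loopless.irrefl _)

end Words

/-! ### Lexicographic normal forms with respect to colors -/

section Lex

variable {J : Type*} [LinearOrder J] {X : J → Type*} {I : SimpleGraph J}
  {w v : List (Σ i, X i)}

/-- Every suffix of the word starts with the smallest color that is available in it. -/
def LexNormal (I : SimpleGraph J) : List (Σ i, X i) → Prop
  | [] => True
  | a :: w => (∀ c, Avail I c (a :: w) → a.1 ≤ c) ∧ LexNormal I w

theorem LexNormal.of_append_right (h : LexNormal I (w ++ v)) : LexNormal I v := by
  induction w with
  | nil => exact h
  | cons a w ih => exact ih h.2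

theorem LexNormal.of_append_left (h : LexNormal I (w ++ v)) : LexNormal I w := by
  induction w with
  | nil => trivial
  | cons a w ih => exact ⟨fun c hc => h.1 c (hc.append v), ih h.2⟩

theorem LexNormal.of_infix (h : LexNormal I v) (hw : w <:+: v) : LexNormal I w := by
  obtain ⟨s, t, rfl⟩ := hw
  exact h.of_append_left.of_append_right

/-- At the first difference the colors differ, because the projections to a single color agree.
There `w` has the smaller color, being the least available one. So the order among letters of equal
color plays no role. -/
theorem LexNormal.eq_or_lex {r : (Σ i, X i) → (Σ i, X i) → Prop}
    (hr : ∀ a b : Σ i, X i, a.1 < b.1 → r a b) (hw : LexNormal I w) (h : TraceEq I w v) :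
    v = w ∨ List.Lex r w v := by
  induction w generalizing v with
  | nil => exact Or.inl h.eq_nil
  | cons a w ih =>
    cases v with
    | nil => exact absurd h.symm.eq_nil (by simp)
    | cons b v =>
      rcases (hw.1 _ (avail_of_traceEq_cons h)).lt_or_eq with hlt | heq
      · exact Or.inr (.rel (hr _ _ hlt))
      · have h1 := h.filter_eq a.1
        rw [List.filter_cons_of_pos (by simp), List.filter_cons_of_pos (by simp [heq])] at h1
        obtain rfl := (List.cons.inj h1).1
        rcases ih hw.2 h.of_cons with rfl | h2
        · exact Or.inl rfl
        · exact Or.inr (.cons h2)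

theorem LexNormal.eq_of_traceEq (hw : LexNormal I w) (hv : LexNormal I v) (h : TraceEq I w v) :
    w = v := by
  induction w generalizing v with
  | nil => exact h.eq_nil.symm
  | cons a w ih =>
    cases v with
    | nil => exact absurd h.symm.eq_nil (by simp)
    | cons b v =>
      have heq := (hw.1 _ (avail_of_traceEq_cons h)).antisymm
        (hv.1 _ (avail_of_traceEq_cons h.symm))
      have h1 := h.filter_eq a.1
      rw [List.filter_cons_of_pos (by simp), List.filter_cons_of_pos (by simp [heq])] at h1
      obtain rfl := (List.cons.inj h1).1
      rw [ih hw.2 hv.2 h.of_cons]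

theorem exists_lexNormal (w : List (Σ i, X i)) : ∃ v, LexNormal I v ∧ TraceEq I w v := by
  induction hn : w.length generalizing w with
  | zero => exact ⟨[], trivial, by rw [List.length_eq_zero_iff.1 hn]; exact .refl _⟩
  | succ n ih =>
    have hfin : {c | Avail I c w}.Finite :=
      (List.finite_toSet (w.map Sigma.fst)).subset fun c hc => by
        obtain ⟨a, ha, rfl⟩ := Avail.exists_mem hc
        exact List.mem_map_of_mem ha
    have hne : {c | Avail I c w}.Nonempty := by
      cases w with
      | nil => simp at hn
      | cons a w => exact ⟨a.1, Or.inl rfl⟩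
    obtain ⟨c, hc, hmin⟩ := Set.exists_min_image _ id hfin hne
    obtain ⟨x, u, hu⟩ := Avail.exists_traceEq_cons hc
    obtain ⟨v, hv, huv⟩ := ih u (by
      have := hu.length_eq
      rw [List.length_cons] at this
      omega)
    have hwv := hu.trans (huv.cons _)
    exact ⟨⟨c, x⟩ :: v, ⟨fun d hd => hmin d (hd.congr hwv.symm), hv⟩, hwv⟩

end Lex

/-! ### Reduced words -/

section Reduced

variable {J : Type*} [DecidableEq J] {X : J → Type*} {I : SimpleGraph J}
  {w v : List (Σ i, X i)}

/-- No two letters of the same color can be moved next to each other. -/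
def Reduced (I : SimpleGraph J) : List (Σ i, X i) → Prop
  | [] => True
  | a :: w => ¬ Avail I a.1 w ∧ Reduced I w

theorem Reduced.of_append_right (h : Reduced I (w ++ v)) : Reduced I v := by
  induction w with
  | nil => exact h
  | cons a w ih => exact ih h.2

theorem Reduced.of_append_left (h : Reduced I (w ++ v)) : Reduced I w := by
  induction w with
  | nil => trivial
  | cons a w ih => exact ⟨fun hc => h.1 (hc.append v), ih h.2⟩

theorem Reduced.insert {x : Σ i, X i} (h : Reduced I (w ++ v)) (hx : ¬ Avail I x.1 (w ++ v))
    (hw : ∀ z ∈ w, I.Adj z.1 x.1) : Reduced I (w ++ x :: v) := by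
  induction w with
  | nil => exact ⟨hx, h⟩
  | cons z w ih =>
    simp only [List.mem_cons, forall_eq_or_imp] at hw
    refine ⟨fun hz => h.1 ?_, ih h.2 (fun hc => hx (Or.inr ⟨hw.1, hc⟩)) hw.2⟩
    replace hz : Avail I z.1 (w ++ x :: v) := hz
    change Avail I z.1 (w ++ v)
    rw [avail_append_iff] at hz ⊢
    rcases hz with hz | ⟨hz, h2 | h2⟩
    · exact Or.inl hz
    · rw [h2] at hw; exact absurd hw.1 (I.loopless.irrefl _)
    · exact Or.inr ⟨hz, h2.2⟩

theorem Reduced.congr (h : Reduced I w) (hv : TraceEq I w v) : Reduced I v := by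
  induction w generalizing v with
  | nil => rw [hv.eq_nil]; trivial
  | cons x w ih =>
    obtain ⟨v₁, v₂, rfl, h1, h2⟩ := hv.exists_of_cons
    exact (ih h.2 h2).insert (fun hc => h.1 (hc.congr h2.symm)) h1

/-- Both factors are reduced, so a pair that can be merged must straddle the boundary. -/
theorem not_reduced_append (hw : Reduced I w) (hv : Reduced I v) (h : ¬ Reduced I (w ++ v)) :
    ∃ e x e' f y f', w = e ++ x :: e' ∧ v = f ++ y :: f' ∧ x.1 = y.1 ∧
      (∀ z ∈ e', I.Adj z.1 x.1) ∧ ∀ z ∈ f, I.Adj z.1 x.1 := by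
  induction w with
  | nil => exact absurd hv h
  | cons a w ih =>
    by_cases hr : Reduced I (w ++ v)
    · have ha : Avail I a.1 (w ++ v) := by
        by_contra hn; exact h ⟨hn, hr⟩
      rcases avail_append_iff.1 ha with ha | ⟨ha1, ha2⟩
      · exact absurd ha hw.1
      · obtain ⟨f, y, f', rfl, h1, h2⟩ := avail_iff.1 ha2
        exact ⟨[], a, w, f, y, f', rfl, rfl, h1.symm, ha1, h2⟩
    · obtain ⟨e, x, e', f, y, f', rfl, rfl, h1⟩ := ih hw.2 hr
      exact ⟨a :: e, x, e', f, y, f', rfl, rfl, h1⟩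

theorem Reduced.not_of_pair {e f g : List (Σ i, X i)} {x y : Σ i, X i}
    (h : Reduced I (e ++ x :: (f ++ y :: g))) (hxy : y.1 = x.1) :
    ¬ ∀ z ∈ f, I.Adj z.1 x.1 := fun hf =>
  h.of_append_right.1 (avail_iff.2 ⟨f, y, g, rfl, hxy, hf⟩)

theorem exists_pair_of_not_reduced (h : ¬ Reduced I w) :
    ∃ e x f y g, w = e ++ x :: (f ++ y :: g) ∧ y.1 = x.1 ∧ ∀ z ∈ f, I.Adj z.1 x.1 := by
  induction w with
  | nil => exact absurd trivial h
  | cons a w ih =>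
    by_cases hr : Reduced I w
    · have ha : Avail I a.1 w := by
        by_contra hn; exact h ⟨hn, hr⟩
      obtain ⟨f, y, g, rfl, h1, h2⟩ := avail_iff.1 ha
      exact ⟨[], a, f, y, g, rfl, h1, h2⟩
    · obtain ⟨e, x, f, y, g, rfl, h1⟩ := ih hr
      exact ⟨a :: e, x, f, y, g, rfl, h1⟩

theorem avail_replace {c : J} {e g : List (Σ i, X i)} {x y : Σ i, X i} (hxy : x.1 = y.1) :
    Avail I c (e ++ x :: g) ↔ Avail I c (e ++ y :: g) := by
  simp only [avail_append_iff, Avail, hxy]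

theorem Reduced.replace {e g : List (Σ i, X i)} {x y : Σ i, X i} (hxy : x.1 = y.1)
    (h : Reduced I (e ++ x :: g)) : Reduced I (e ++ y :: g) := by
  induction e with
  | nil => exact ⟨hxy ▸ h.1, h.2⟩
  | cons a e ih => exact ⟨fun hc => h.1 ((avail_replace hxy).2 hc), ih h.2⟩

end Reduced

/-! ### Uniqueness of reduced traces, by an action on them -/

section Uniqueness

variable {J : Type*} [DecidableEq J] (I : SimpleGraph J) (M : J → Type*) [∀ i, Monoid (M i)]

/-- The element of the graph product represented by a word over the nontrivial elements of the
local monoids. -/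
def eval (w : List (BigLetter M)) : GraphProduct I M :=
  (w.map fun a => ofLocal I M a.1 a.2.1).prod

@[simp] theorem eval_nil : eval I M [] = 1 := rfl

@[simp] theorem eval_cons (a : BigLetter M) (w : List (BigLetter M)) :
    eval I M (a :: w) = ofLocal I M a.1 a.2.1 * eval I M w := by simp [eval]

@[simp] theorem eval_append (w v : List (BigLetter M)) :
    eval I M (w ++ v) = eval I M w * eval I M v := by simp [eval]

theorem psi_toTrace (w : List (BigLetter M)) :
    psi I M (toTrace _ (FreeMonoid.ofList w)) = eval I M w := by
  rw [psi, traceLift_toTrace, FreeMonoid.lift_apply]; rfl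

variable {I M}

theorem TraceEq.eval_eq {w v : List (BigLetter M)} (h : TraceEq I w v) :
    eval I M w = eval I M v := by
  rw [← psi_toTrace, ← psi_toTrace, toTrace_eq_of_traceEq h]

open Classical in
/-- Prefix a word by an element of a local monoid, which is omitted if it is trivial. -/
noncomputable def consLocal {i : J} (m : M i) (w : List (BigLetter M)) : List (BigLetter M) :=
  if h : m = 1 then w else ⟨i, m, h⟩ :: w

@[simp] theorem consLocal_one {i : J} (w : List (BigLetter M)) :
    consLocal (1 : M i) w = w := by simp [consLocal]

theorem consLocal_of_ne {i : J} {m : M i} (h : m ≠ 1) (w : List (BigLetter M)) :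
    consLocal m w = ⟨i, m, h⟩ :: w := by simp [consLocal, h]

theorem eval_consLocal {i : J} (m : M i) (w : List (BigLetter M)) :
    eval I M (consLocal m w) = ofLocal I M i m * eval I M w := by
  by_cases h : m = 1
  · subst h; simp
  · simp [consLocal_of_ne h]

theorem Reduced.consLocal {i : J} (m : M i) {w : List (BigLetter M)} (hw : Reduced I w)
    (hi : ¬ Avail I i w) : Reduced I (consLocal m w) := by
  by_cases h : m = 1
  · subst h; simpa
  · rw [consLocal_of_ne h]; exact ⟨hi, hw⟩

theorem TraceEq.consLocal {i : J} (m : M i) {w v : List (BigLetter M)} (h : TraceEq I w v) :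
    TraceEq I (consLocal m w) (GraphProd.consLocal m v) := by
  by_cases hm : m = 1
  · subst hm; simpa
  · rw [consLocal_of_ne hm, consLocal_of_ne hm]; exact h.cons _

theorem avail_consLocal {i j : J} (hij : I.Adj i j) (m : M i) (w : List (BigLetter M)) :
    Avail I j (consLocal m w) ↔ Avail I j w := by
  by_cases hm : m = 1
  · subst hm; simp
  · rw [consLocal_of_ne hm, Avail]
    have : i ≠ j := hij.ne
    simp [this, hij]

theorem consLocal_comm {i j : J} (hij : I.Adj i j) (m : M i) (n : M j) (w : List (BigLetter M)) :
    TraceEq I (consLocal m (consLocal n w)) (consLocal n (consLocal m w)) := by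
  by_cases hm : m = 1
  · subst hm; simpa using .refl _
  by_cases hn : n = 1
  · subst hn; simpa using .refl _
  rw [consLocal_of_ne hm, consLocal_of_ne hn, consLocal_of_ne hn, consLocal_of_ne hm]
  exact TraceEq.move (v₁ := [⟨i, m, hm⟩]) (x := ⟨j, n, hn⟩) (by simpa using hij) w

/-- The element split off at color `i` and the trace of the rest are unique; this makes the action
`ReducedTrace.act` independent of choices. -/
theorem consLocal_injective {i : J} {m n : M i} {w v : List (BigLetter M)}
    (hw : ¬ Avail I i w) (hv : ¬ Avail I i v) (h : TraceEq I (consLocal m w) (consLocal n v)) :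
    m = n ∧ TraceEq I w v := by
  by_cases hm : m = 1
  · by_cases hn : n = 1
    · subst hm hn; simpa using h
    · subst hm
      rw [consLocal_one, consLocal_of_ne hn] at h
      exact absurd (avail_of_traceEq_cons h) hw
  · by_cases hn : n = 1
    · subst hn
      rw [consLocal_one, consLocal_of_ne hm] at h
      exact absurd (avail_of_traceEq_cons h.symm) hv
    · rw [consLocal_of_ne hm, consLocal_of_ne hn] at h
      have h1 := h.filter_eq i
      rw [List.filter_cons_of_pos (by simp), List.filter_cons_of_pos (by simp)] at h1
      have h2 := (List.cons.inj h1).1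
      obtain rfl : m = n := by simpa using h2
      exact ⟨rfl, h.of_cons⟩

theorem Reduced.exists_consLocal (i : J) {w : List (BigLetter M)} (hw : Reduced I w) :
    ∃ (m : M i) (v : List (BigLetter M)), Reduced I v ∧ ¬ Avail I i v ∧
      TraceEq I w (GraphProd.consLocal m v) := by
  by_cases h : Avail I i w
  · obtain ⟨x, v, hv⟩ := h.exists_traceEq_cons
    have hr := hw.congr hv
    exact ⟨x.1, v, hr.2, hr.1, by rw [consLocal_of_ne x.2]; exact hv⟩
  · exact ⟨1, w, hw, h, by simpa using .refl _⟩

variable (I M)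

/-- Trace equivalence of reduced words. -/
def reducedSetoid : Setoid {w : List (BigLetter M) // Reduced I w} where
  r w v := TraceEq I w.1 v.1
  iseqv := ⟨fun _ => .refl _, fun h => h.symm, fun h h' => h.trans h'⟩

/-- Reduced words up to trace equivalence. -/
def ReducedTrace : Type _ := Quotient (reducedSetoid I M)

variable {I M}

/-- The class of a reduced word. -/
def ReducedTrace.mk (w : List (BigLetter M)) (hw : Reduced I w) : ReducedTrace I M :=
  Quotient.mk (reducedSetoid I M) ⟨w, hw⟩

theorem ReducedTrace.mk_eq_iff {w v : List (BigLetter M)} {hw : Reduced I w} {hv : Reduced I v} :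
    ReducedTrace.mk w hw = .mk v hv ↔ TraceEq I w v :=
  ⟨fun h => Quotient.exact h, fun h => Quotient.sound h⟩

theorem ReducedTrace.exists_consLocal (i : J) (t : ReducedTrace I M) :
    ∃ (m : M i) (v : List (BigLetter M)) (hv : Reduced I v) (hi : ¬ Avail I i v),
      t = .mk (consLocal m v) (hv.consLocal m hi) := by
  induction t using Quotient.inductionOn with
  | h w =>
    obtain ⟨m, v, h1, h2, h3⟩ := w.2.exists_consLocal i
    exact ⟨m, v, h1, h2, mk_eq_iff.2 h3⟩

open Classical in
/-- The action of a local monoid on reduced traces. -/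
noncomputable def ReducedTrace.act {i : J} (n : M i) (t : ReducedTrace I M) : ReducedTrace I M :=
  let h := t.exists_consLocal i
  let h' := h.choose_spec.choose_spec
  .mk (consLocal (n * h.choose) h.choose_spec.choose) (h'.choose.consLocal _ h'.choose_spec.choose)

theorem ReducedTrace.act_mk {i : J} (n m : M i) {v : List (BigLetter M)} (hv : Reduced I v)
    (hi : ¬ Avail I i v) : act n (.mk (consLocal m v) (hv.consLocal m hi)) =
      .mk (consLocal (n * m) v) (hv.consLocal (n * m) hi) := by
  let t : ReducedTrace I M := .mk (consLocal m v) (hv.consLocal m hi)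
  have h := t.exists_consLocal i
  have h' := h.choose_spec.choose_spec
  obtain ⟨h1, h2⟩ := consLocal_injective hi h'.choose_spec.choose
    (mk_eq_iff.1 h'.choose_spec.choose_spec)
  refine mk_eq_iff.2 ((h2.symm.consLocal (n * h.choose)).trans ?_)
  rw [congrArg (fun z => GraphProd.consLocal (n * z) v) h1]
  exact .refl _

/-- The action of a local monoid on reduced traces, as a homomorphism. -/
noncomputable def ReducedTrace.actHom (i : J) : M i →* Function.End (ReducedTrace I M) where
  toFun n := act n
  map_one' := by
    funext t
    obtain ⟨m, v, hv, hi, rfl⟩ := t.exists_consLocal i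
    change act 1 _ = _
    rw [act_mk 1 m hv hi]; simp only [one_mul]; rfl
  map_mul' n n' := by
    funext t
    obtain ⟨m, v, hv, hi, rfl⟩ := t.exists_consLocal i
    change act (n * n') _ = act n (act n' _)
    rw [act_mk _ m hv hi, act_mk _ m hv hi, act_mk _ _ hv hi]; simp only [mul_assoc]

/-- After splitting off both colors, the trace is `m m' u` with neither color available in `u`, and
the two multiplications act on separate factors. -/
theorem ReducedTrace.act_comm {i j : J} (hij : I.Adj i j) (n : M i) (n' : M j)
    (t : ReducedTrace I M) : act n (act n' t) = act n' (act n t) := by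
  obtain ⟨m, v, hv, hi, rfl⟩ := t.exists_consLocal i
  obtain ⟨m', u, hu, hj, hvu⟩ := hv.exists_consLocal j
  have hiu : ¬ Avail I i u := fun h => hi (((avail_consLocal hij.symm m' u).2 h).congr hvu.symm)
  have hj' (x : M i) : ¬ Avail I j (consLocal x u) := fun h => hj ((avail_consLocal hij x u).1 h)
  have hi' (y : M j) : ¬ Avail I i (consLocal y u) :=
    fun h => hiu ((avail_consLocal hij.symm y u).1 h)
  have key (x : M i) (y : M j) : ReducedTrace.mk (consLocal x (consLocal y u))
      ((hu.consLocal y hj).consLocal x (hi' y)) =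
      .mk (consLocal y (consLocal x u)) ((hu.consLocal x hiu).consLocal y (hj' x)) :=
    mk_eq_iff.2 (consLocal_comm hij x y u)
  have h0 : ReducedTrace.mk (consLocal m v) (hv.consLocal m hi) =
      .mk (consLocal m (consLocal m' u)) ((hu.consLocal m' hj).consLocal m (hi' m')) :=
    mk_eq_iff.2 (hvu.consLocal m)
  have hA (x : M i) := hu.consLocal x hiu
  have hB (y : M j) := hu.consLocal y hj
  rw [h0, act_mk n m (hB _) (hi' _), key, key, act_mk n' m' (hA _) (hj' _),
    act_mk n' m' (hA _) (hj' _), ← key, ← key, act_mk n m (hB _) (hi' _)]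

variable (I M) in
/-- The action of the graph product on reduced traces. -/
noncomputable def ReducedTrace.action : GraphProduct I M →* Function.End (ReducedTrace I M) :=
  (conGen (graphProdRel I M)).lift (Monoid.CoprodI.lift actHom) <| Con.conGen_le.2 <| by
    rintro _ _ ⟨j, k, x, y, hjk, rfl, rfl⟩
    rw [Con.ker_rel, map_mul, map_mul, Monoid.CoprodI.lift_of, Monoid.CoprodI.lift_of]
    funext t
    exact act_comm hjk x y t

theorem ReducedTrace.action_ofLocal {i : J} (m : M i) (t : ReducedTrace I M) :
    action I M (ofLocal I M i m) t = act m t := by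
  change Monoid.CoprodI.lift actHom (Monoid.CoprodI.of m) t = _
  rw [Monoid.CoprodI.lift_of]; rfl

theorem ReducedTrace.action_eval {w : List (BigLetter M)} (hw : Reduced I w) :
    action I M (eval I M w) (.mk [] trivial) = .mk w hw := by
  induction w with
  | nil => rw [eval_nil, map_one]; rfl
  | cons a w ih =>
    rw [eval_cons, map_mul]
    change action I M (ofLocal I M a.1 a.2.1) (action I M (eval I M w) (.mk [] trivial)) = _
    rw [ih hw.2, action_ofLocal]
    -- The color of `a` is not available in `w`, so the element split off from `w` is `1` and `a` is
    -- simply prefixed.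
    have := act_mk a.2.1 1 hw.2 hw.1
    simp only [consLocal_one, mul_one, consLocal_of_ne a.2.2] at this
    exact this

/-- Reduced words that represent the same element of the graph product are trace equivalent. -/
theorem Reduced.traceEq_of_eval_eq {w v : List (BigLetter M)} (hw : Reduced I w)
    (hv : Reduced I v) (h : eval I M w = eval I M v) : TraceEq I w v := by
  rw [← ReducedTrace.mk_eq_iff (hw := hw) (hv := hv), ← ReducedTrace.action_eval hw, h,
    ReducedTrace.action_eval hv]

end Uniqueness

/-! ### Exponents of periodicity -/

section Exponent

variable {A B : Type*}

theorem one_le_length_of_ne_one {w : FreeMonoid A} (h : w ≠ 1) : 1 ≤ w.length :=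
  Nat.one_le_iff_ne_zero.2 fun h0 => h (FreeMonoid.length_eq_zero.1 h0)

theorem length_freeMonoid_pow (w : FreeMonoid A) (n : ℕ) : (w ^ n).length = n * w.length := by
  induction n with
  | zero => simp
  | succ n ih => rw [pow_succ, FreeMonoid.length_mul, ih]; ring

theorem le_length_of_eq {w u p v : FreeMonoid A} {e : ℕ} (hp : p ≠ 1) (h : w = u * p ^ e * v) :
    e ≤ w.length := by
  rw [h, FreeMonoid.length_mul, FreeMonoid.length_mul, length_freeMonoid_pow]
  have := Nat.mul_le_mul_left e (one_le_length_of_ne_one hp)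
  omega

theorem le_expWord {w u p v : FreeMonoid A} {e : ℕ} (hp : p ≠ 1) (h : w = u * p ^ e * v) :
    e ≤ expWord w :=
  le_csSup ⟨w.length, by rintro e ⟨u, p, v, hp, h⟩; exact le_length_of_eq hp h⟩
    ⟨u, p, v, hp, h⟩

theorem expWord_le {w : FreeMonoid A} {n : ℕ}
    (h : ∀ (e : ℕ) (u p v : FreeMonoid A), p ≠ 1 → w = u * p ^ e * v → e ≤ n) : expWord w ≤ n := by
  unfold expWord
  rcases Set.eq_empty_or_nonempty {e : ℕ | ∃ u p v : FreeMonoid A, p ≠ 1 ∧ w = u * p ^ e * v}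
    with h0 | h0
  · rw [h0]; simp
  · exact csSup_le h0 (by rintro e ⟨u, p, v, hp, h'⟩; exact h e u p v hp h')

theorem expWord_le_mul (s w t : FreeMonoid A) : expWord w ≤ expWord (s * w * t) := by
  refine expWord_le fun e u p v hp h => le_expWord (u := s * u) (v := v * t) hp ?_
  rw [h]; simp only [mul_assoc]

theorem expWord_le_map (f : A → B) (w : FreeMonoid A) :
    expWord w ≤ expWord (FreeMonoid.map f w) := by
  refine expWord_le fun e u p v hp h => le_expWord (u := FreeMonoid.map f u)
    (p := FreeMonoid.map f p) (v := FreeMonoid.map f v) ?_ (by rw [h]; simp only [map_mul, map_pow])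
  intro h0
  have := congrArg FreeMonoid.length h0
  exact hp (FreeMonoid.length_eq_zero.1 ((List.length_map (as := p.toList) f).symm.trans this))

theorem expLang_ne_top_of_finite {L : Set (FreeMonoid A)} (hL : L.Finite) : expLang L ≠ ⊤ := by
  obtain ⟨n, hn⟩ := (hL.image expWord).bddAbove
  refine ne_top_of_le_ne_top (ENat.natCast_ne_top n) (iSup₂_le fun w hw => ?_)
  exact_mod_cast hn ⟨w, hw, rfl⟩

theorem expLang_eq_top_iff {L : Set (FreeMonoid A)} :
    expLang L = ⊤ ↔ ∀ n : ℕ, ∃ w ∈ L, n ≤ expWord w := by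
  rw [expLang, ENat.eq_top_iff_forall_ge]
  constructor
  · intro h n
    by_contra! hn
    have h1 : expLang L ≤ n := iSup₂_le fun w hw => by exact_mod_cast (hn w hw).le
    have h2 := (h (n + 1)).trans h1
    have : n + 1 ≤ n := by exact_mod_cast h2
    omega
  · intro h n
    obtain ⟨w, hw, hn⟩ := h n
    exact le_trans (by exact_mod_cast hn) (le_iSup₂ (f := fun w _ => (expWord w : ℕ∞)) w hw)

/-- Only the implication from infinite languages to infinite exponents is not automatic. -/
theorem periodicallyNice_iff {L : Set (FreeMonoid A)} :
    PeriodicallyNice L ↔ (L.Infinite → ∀ n : ℕ, ∃ w ∈ L, n ≤ expWord w) := by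
  rw [← expLang_eq_top_iff]
  exact ⟨fun h => h.2, fun h => ⟨fun h' hf => expLang_ne_top_of_finite hf h', h⟩⟩

theorem PeriodicallyNice.insert {L : Set (FreeMonoid A)} (h : PeriodicallyNice L)
    (w : FreeMonoid A) : PeriodicallyNice (insert w L) := by
  rw [periodicallyNice_iff] at *
  intro hi n
  obtain ⟨v, hv, hn⟩ := h (fun hf => hi (hf.insert w)) n
  exact ⟨v, Or.inr hv, hn⟩

theorem PeriodicallyPerfect.insert {L : Set (FreeMonoid A)} (h : PeriodicallyPerfect L)
    (w : FreeMonoid A) : PeriodicallyPerfect (insert w L) := by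
  intro n
  obtain ⟨N, hN⟩ := h n
  -- The second bound excludes the inserted word.
  refine ⟨max N (w.length + 1), ?_⟩
  rintro v (rfl | hv) hle
  · omega
  · exact hN v hv (le_trans (le_max_left _ _) hle)

end Exponent

/-! ### The global normal form as a substituted word -/

section GlobalNF

variable {J : Type*} [LinearOrder J] {I : SimpleGraph J} {M : J → Type*} [∀ i, Monoid (M i)]
  {Γ : J → Type*} (nf : ∀ i, M i → FreeMonoid (Γ i))

/-- The concatenation of the local normal forms of the letters of a word. -/
def flatNF (w : List (BigLetter M)) : List (Σ i, Γ i) :=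
  w.flatMap fun a => (nf a.1 a.2.1).toList.map (Sigma.mk a.1)

@[simp] theorem flatNF_cons (a : BigLetter M) (w : List (BigLetter M)) :
    flatNF nf (a :: w) = (nf a.1 a.2.1).toList.map (Sigma.mk a.1) ++ flatNF nf w := by
  simp [flatNF]

@[simp] theorem flatNF_append (w v : List (BigLetter M)) :
    flatNF nf (w ++ v) = flatNF nf w ++ flatNF nf v := by
  simp [flatNF]

theorem substNF_toTrace (w : List (BigLetter M)) :
    substNF I M nf (toTrace _ (FreeMonoid.ofList w)) =
      toTrace _ (FreeMonoid.ofList (flatNF nf w)) := by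
  rw [substNF, traceLift_toTrace]
  induction w with
  | nil => rfl
  | cons a w ih =>
    rw [FreeMonoid.ofList_cons, map_mul, ih, FreeMonoid.lift_eval_of, flatNF_cons,
      FreeMonoid.ofList_append, map_mul]
    rfl

variable {nf}

theorem avail_map_append {i : J} {l : List (Γ i)} (hl : l ≠ []) (c : J) (v : List (Σ i, Γ i)) :
    Avail I c (l.map (Sigma.mk i) ++ v) ↔ i = c ∨ I.Adj i c ∧ Avail I c v := by
  induction l with
  | nil => exact absurd rfl hl
  | cons a l ih =>
    by_cases h : l = []
    · subst h; rfl
    · rw [List.map_cons, List.cons_append, Avail, ih h]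
      by_cases hi : i = c <;> simp [hi]

/-- Availability depends on colors only, and each letter is replaced by a nonempty block of its own
color. -/
theorem avail_flatNF (hnf : ∀ i m, m ≠ 1 → nf i m ≠ 1) (c : J) (w : List (BigLetter M)) :
    Avail I c (flatNF nf w) ↔ Avail I c w := by
  induction w with
  | nil => rfl
  | cons a w ih => 
    rw [flatNF_cons]
    refine (avail_map_append (l := (nf a.1 a.2.1).toList) (hnf _ _ a.2.2) c _).trans ?_
    rw [ih]; rfl

theorem lexNormal_map_append {i : J} {l : List (Γ i)} {v : List (Σ i, Γ i)}
    (h : ∀ c, I.Adj i c → Avail I c v → i ≤ c) (hv : LexNormal I v) :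
    LexNormal I (l.map (Sigma.mk i) ++ v) := by
  induction l with
  | nil => exact hv
  | cons a l ih =>
    refine ⟨fun c hc => ?_, ih⟩
    replace hc := (avail_map_append (List.cons_ne_nil a l) c v).1 hc
    rcases hc with rfl | ⟨h1, h2⟩
    · exact le_rfl
    · exact h c h1 h2

theorem LexNormal.flatNF (hnf : ∀ i m, m ≠ 1 → nf i m ≠ 1) {w : List (BigLetter M)}
    (hw : LexNormal I w) : LexNormal I (flatNF nf w) := by
  induction w with
  | nil => trivial
  | cons a w ih =>
    rw [flatNF_cons]
    exact lexNormal_map_append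
      (fun c h1 h2 => hw.1 c (Or.inr ⟨h1, (avail_flatNF hnf c w).1 h2⟩)) (ih hw.2)

theorem reduced_of_isReduced {w : List (BigLetter M)}
    (h : IsReduced I M (toTrace _ (FreeMonoid.ofList w))) : Reduced I w := by
  by_contra hn
  obtain ⟨e, x, f, y, g, rfl, h1, h2⟩ := exists_pair_of_not_reduced hn
  refine h x y (toTrace _ (FreeMonoid.ofList (e ++ f))) (toTrace _ (FreeMonoid.ofList g)) ?_ h1.symm
  rw [← map_mul, ← map_mul, ← map_mul]
  have := toTrace_eq_of_traceEq (I := I) ((TraceEq.move_last (x := x) h2 e).append_right (y :: g))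
  simpa [FreeMonoid.ofList_append, FreeMonoid.ofList_cons, mul_assoc] using this

variable [∀ i, LinearOrder (Γ i)]

theorem exists_globalNF_eq (hnf : ∀ i m, m ≠ 1 → nf i m ≠ 1) (x : GraphProduct I M) :
    ∃ w, LexNormal I w ∧ Reduced I w ∧ eval I M w = x ∧
      globalNF I M nf x = FreeMonoid.ofList (flatNF nf w) := by
  obtain ⟨h1, h2⟩ := nfBig_spec I M x
  obtain ⟨w₀, hw₀⟩ := toTrace_surjective _ (nfBig I M x)
  obtain ⟨w, hw, hw'⟩ := exists_lexNormal (I := I) w₀.toList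
  have hr := toTrace_eq_of_traceEq hw'
  rw [FreeMonoid.ofList_toList, hw₀] at hr
  rw [hr] at h1 h2
  rw [psi_toTrace] at h2
  refine ⟨w, hw, reduced_of_isReduced h1, h2, ?_⟩
  rw [globalNF, hr, substNF_toTrace]
  obtain ⟨h3, h4⟩ := nfLex_spec _ (letterLT Γ)
    (toTrace (I.comap Sigma.fst) (FreeMonoid.ofList (flatNF nf w)))
  set F := nfLex _ (letterLT Γ) (toTrace (I.comap Sigma.fst) (FreeMonoid.ofList (flatNF nf w)))
  have h5 := (hw.flatNF hnf).eq_or_lex (r := letterLT Γ) (fun a b hab => Sigma.Lex.left _ _ hab)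
    (traceEq_of_toTrace_eq h3.symm)
  -- Each of the two words equals or precedes the other, so asymmetry of the order makes them equal.
  rcases h4 _ rfl with h4 | h4
  · exact h4.symm
  rcases h5 with h5 | h5
  · exact h5
  · exact absurd h4 (asymm_of (List.Lex (letterLT Γ)) h5)

theorem globalPi_ofList_flatNF (π : ∀ i, FreeMonoid (Γ i) →* M i)
    (h : ∀ i, IsNormalForm (π i) (nf i)) (w : List (BigLetter M)) :
    globalPi I M π (FreeMonoid.ofList (flatNF nf w)) = eval I M w := by
  induction w with
  | nil => rfl
  | cons a w ih =>
    have key : ∀ l : FreeMonoid (Γ a.1), globalPi I M π (FreeMonoid.map (Sigma.mk a.1) l) =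
        ofLocal I M a.1 (π a.1 l) := by
      intro l
      induction l using FreeMonoid.inductionOn' with
      | one => simp only [map_one]
      | of_mul b l ih =>
        rw [map_mul, map_mul, ih, map_mul, map_mul]
        rfl
    rw [flatNF_cons, FreeMonoid.ofList_append, map_mul, ih, eval_cons]
    congr 1
    refine (key (nf a.1 a.2.1)).trans ?_
    rw [h]

theorem isNormalForm_ne_one {A N : Type*} [Monoid N] {π : FreeMonoid A →* N}
    {nf : N → FreeMonoid A} (h : IsNormalForm π nf) (m : N) (hm : m ≠ 1) : nf m ≠ 1 := fun h1 =>
  hm (by rw [← h m, h1, map_one])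

theorem isNormalForm_globalNF (π : ∀ i, FreeMonoid (Γ i) →* M i)
    (h : ∀ i, IsNormalForm (π i) (nf i)) :
    IsNormalForm (globalPi I M π) (globalNF I M nf) := by
  intro x
  obtain ⟨w, -, -, rfl, hw⟩ := exists_globalNF_eq (fun i => isNormalForm_ne_one (h i)) x
  rw [hw, globalPi_ofList_flatNF π h]

theorem expWord_le_flatNF {a : BigLetter M} {w : List (BigLetter M)} (h : a ∈ w) :
    expWord (nf a.1 a.2.1) ≤ expWord (FreeMonoid.ofList (flatNF nf w)) := by
  obtain ⟨s, t, rfl⟩ := List.append_of_mem h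
  rw [flatNF_append, flatNF_cons, FreeMonoid.ofList_append, FreeMonoid.ofList_append, ← mul_assoc]
  exact (expWord_le_map (Sigma.mk a.1) _).trans (expWord_le_mul ..)

theorem flatNF_flatten_replicate (n : ℕ) (y : List (BigLetter M)) :
    FreeMonoid.ofList (flatNF nf (List.replicate n y).flatten) =
      FreeMonoid.ofList (flatNF nf y) ^ n := by
  induction n with
  | zero => rfl
  | succ n ih =>
    rw [List.replicate_succ, List.flatten_cons, flatNF_append, FreeMonoid.ofList_append, ih,
      pow_succ']

theorem le_expWord_flatNF (hnf : ∀ i m, m ≠ 1 → nf i m ≠ 1) {n : ℕ} {y w : List (BigLetter M)}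
    (hy : y ≠ []) (h : (List.replicate n y).flatten <:+: w) :
    n ≤ expWord (FreeMonoid.ofList (flatNF nf w)) := by
  obtain ⟨s, t, rfl⟩ := h
  refine le_expWord (u := FreeMonoid.ofList (flatNF nf s)) (p := FreeMonoid.ofList (flatNF nf y))
    (v := FreeMonoid.ofList (flatNF nf t)) ?_ ?_
  · cases y with
    | nil => exact absurd rfl hy
    | cons a y =>
      intro h0
      rw [flatNF_cons, FreeMonoid.ofList_append] at h0
      refine hnf a.1 a.2.1 a.2.2 ?_
      have := congrArg FreeMonoid.length h0
      rw [FreeMonoid.length_mul, FreeMonoid.length_one] at this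
      refine FreeMonoid.length_eq_zero.1 ?_
      have h2 : (FreeMonoid.ofList ((nf a.1 a.2.1).toList.map (Sigma.mk a.1))).length =
        (nf a.1 a.2.1).length := List.length_map ..
      omega
  · rw [flatNF_append, flatNF_append, FreeMonoid.ofList_append, FreeMonoid.ofList_append,
      flatNF_flatten_replicate]

end GlobalNF

/-! ### Periodic lists and cutting of lists -/

section ListLemmas

variable {A : Type*}

theorem take_mul_eq_of_periodic (l : List A) (p k : ℕ) (hk : k * p ≤ l.length)
    (h : ∀ i, i + p < k * p → l[i]? = l[i + p]?) :
    l.take (k * p) = (List.replicate k (l.take p)).flatten := by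
  induction k generalizing l with
  | zero => simp
  | succ k ih =>
    rw [Nat.succ_mul] at hk h ⊢
    rw [add_comm (k * p) p, List.take_add, List.replicate_succ, List.flatten_cons, ih]
    · rcases Nat.eq_zero_or_pos k with rfl | hk0
      · simp
      · congr 3
        refine List.ext_getElem? fun i => ?_
        by_cases hi : i < p
        · have hp := Nat.le_mul_of_pos_left p hk0
          rw [List.getElem?_take_of_lt hi, List.getElem?_take_of_lt hi, List.getElem?_drop,
            h i (by omega), add_comm]
        · rw [List.getElem?_take_eq_none (by omega), List.getElem?_take_eq_none (by omega)]
    · rw [List.length_drop]; omega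
    · intro i hi
      rw [List.getElem?_drop, List.getElem?_drop, ← add_assoc, add_comm p i, h (i + p) (by omega)]

theorem exists_split_countP (p : A → Bool) {l : List A} {n : ℕ} (h : n ≤ l.countP p) :
    ∃ l₁ l₂, l = l₁ ++ l₂ ∧ l₁.countP p = n := by
  induction l generalizing n with
  | nil => exact ⟨[], [], rfl, (Nat.le_zero.1 h).symm⟩
  | cons a l ih =>
    cases n with
    | zero => exact ⟨[], a :: l, rfl, rfl⟩
    | succ n =>
      by_cases ha : p a
      · rw [List.countP_cons_of_pos ha] at h
        obtain ⟨l₁, l₂, rfl, h1⟩ := ih (Nat.succ_le_succ_iff.1 h)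
        exact ⟨a :: l₁, l₂, rfl, by rw [List.countP_cons_of_pos ha, h1]⟩
      · rw [List.countP_cons_of_neg ha] at h
        obtain ⟨l₁, l₂, rfl, h1⟩ := ih h
        exact ⟨a :: l₁, l₂, rfl, by rw [List.countP_cons_of_neg ha, h1]⟩

/-- Cut a list before each element that satisfies `p`. -/
theorem exists_blocks (p : A → Bool) (l : List A) : ∃ (z : List A) (ys : List (List A)),
    l = z ++ ys.flatten ∧ z.countP p = 0 ∧ ys.length = l.countP p ∧
      ∀ y ∈ ys, ∃ b y', y = b :: y' ∧ p b ∧ y.countP p = 1 := by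
  induction l with
  | nil => exact ⟨[], [], rfl, rfl, rfl, by simp⟩
  | cons a l ih =>
    obtain ⟨z, ys, rfl, h1, h2, h3⟩ := ih
    by_cases ha : p a
    · refine ⟨[], (a :: z) :: ys, by simp, rfl, ?_, ?_⟩
      · rw [List.countP_cons_of_pos ha, ← h2, List.length_cons]
      · simp only [List.mem_cons, forall_eq_or_imp]
        exact ⟨⟨a, z, rfl, ha, by rw [List.countP_cons_of_pos ha, h1]⟩, h3⟩
    · refine ⟨a :: z, ys, by simp, ?_, ?_, h3⟩
      · rw [List.countP_cons_of_neg ha, h1]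
      · rw [List.countP_cons_of_neg ha, h2]

theorem countP_flatten_blocks {p : A → Bool} {ys : List (List A)}
    (h : ∀ y ∈ ys, y.countP p = 1) : ys.flatten.countP p = ys.length := by
  induction ys with
  | nil => rfl
  | cons y ys ih =>
    simp only [List.mem_cons, forall_eq_or_imp] at h
    rw [List.flatten_cons, List.countP_append, h.1, ih h.2, List.length_cons, add_comm]

theorem mem_of_mem_flatten_replicate {n : ℕ} {q : List A} {x : A}
    (h : x ∈ (List.replicate n q).flatten) : x ∈ q := by
  obtain ⟨l, hl, hx⟩ := List.mem_flatten.1 h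
  rwa [(List.mem_replicate.1 hl).2] at hx

theorem flatten_replicate_succ' (n : ℕ) (q : List A) :
    (List.replicate (n + 1) q).flatten = (List.replicate n q).flatten ++ q := by
  rw [List.replicate_succ', List.flatten_append]; simp

end ListLemmas

/-! ### High powers in lexicographic normal forms -/

section Power

variable {J : Type*} [LinearOrder J] {X : J → Type*} {I : SimpleGraph J}

/-- The number of letters of color `c`. -/
def colorCount (c : J) (w : List (Σ i, X i)) : ℕ := w.countP fun x => x.1 = c

theorem colorCount_append (c : J) (w v : List (Σ i, X i)) :
    colorCount c (w ++ v) = colorCount c w + colorCount c v := List.countP_append ..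

theorem colorCount_cons (c : J) (x : Σ i, X i) (w : List (Σ i, X i)) :
    colorCount c (x :: w) = colorCount c w + if x.1 = c then 1 else 0 := by
  simp [colorCount, List.countP_cons]

theorem colorCount_pos {c : J} {w : List (Σ i, X i)} :
    0 < colorCount c w ↔ ∃ x ∈ w, x.1 = c := by
  simp [colorCount, List.countP_pos_iff]

theorem colorCount_flatten_replicate (c : J) (n : ℕ) (q : List (Σ i, X i)) :
    colorCount c (List.replicate n q).flatten = n * colorCount c q := by
  induction n with
  | zero => simp [colorCount]
  | succ n ih => rw [flatten_replicate_succ', colorCount_append, ih]; ring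

/-- A prefix of a trace is determined by the number of its letters of color `a`, if only this color
is available in the rest. -/
theorem TraceEq.prefix_unique {a : J} {u v u' v' : List (Σ i, X i)}
    (h : TraceEq I (u ++ v) (u' ++ v')) (hc : colorCount a u = colorCount a u')
    (hv : ∀ c, Avail I c v → c = a) (hv' : ∀ c, Avail I c v' → c = a) : TraceEq I u u' := by
  induction u generalizing u' with
  | nil =>
    cases u' with
    | nil => exact .refl _
    | cons b u' =>
      have := hv _ (avail_of_traceEq_cons h)
      rw [colorCount_cons, if_pos this] at hc
      simp [colorCount] at hc
  | cons x u ih =>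
    -- The first letter `x` of `u` cannot come from `v'`: being available there it would have color
    -- `a`, and by the equal counts `u'` would contain a letter of this color, which `x` cannot
    -- pass.
    have key : (∀ z ∈ u', I.Adj z.1 x.1) → Avail I x.1 v' → False := by
      intro h1 h2
      have hx := hv' _ h2
      rw [colorCount_cons, if_pos hx] at hc
      obtain ⟨z, hz, hz'⟩ := colorCount_pos.1 (by omega : 0 < colorCount a u')
      have := h1 z hz
      rw [hz', hx] at this
      exact I.loopless.irrefl _ this
    obtain ⟨v₁, v₂, h1, h2, h3⟩ := h.exists_of_cons
    rcases List.append_eq_append_iff.1 h1 with ⟨d, rfl, rfl⟩ | ⟨d, rfl, h4⟩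
    · exact (key (fun z hz => h2 z (by simp [hz]))
        (avail_iff.2 ⟨d, x, v₂, rfl, rfl, fun z hz => h2 z (by simp [hz])⟩)).elim
    · cases d with
      | nil =>
        rw [List.append_nil] at key
        exact (key h2 (by obtain rfl : x :: v₂ = v' := h4; exact Or.inl rfl)).elim
      | cons y d =>
        rw [List.cons_append] at h4
        obtain ⟨rfl, rfl⟩ := List.cons.inj h4
        refine ((ih (u' := v₁ ++ d) (by simpa using h3) ?_).cons x).trans (TraceEq.move h2 d).symm
        rw [colorCount_cons, colorCount_append, colorCount_cons] at hc
        rw [colorCount_append]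
        omega

/-- Cut `B₁` before each letter of the largest color `a`. Behind a cut only `a` is available, so the
trace of the prefix up to the cut is determined by its number of letters `a`. Because $q\cdot
q^m=q^m\cdot q$, prefixing `q` to one such prefix gives the prefix ending `colorCount a q` cuts
later. Cancelling shows that the sequence of blocks has this period. -/
theorem exists_power_of_factor {q α B₁ B₂ β : List (Σ i, X i)} {a : J} {m K : ℕ}
    (h : TraceEq I (α ++ (B₁ ++ B₂) ++ β) (List.replicate m q).flatten)
    (hB : LexNormal I (B₁ ++ B₂)) (hq : ∀ x ∈ q, ∃ y ∈ B₂, y.1 = x.1) (hmax : ∀ x ∈ q, x.1 ≤ a)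
    (ha : 0 < colorCount a q) (hK : K * colorCount a q < colorCount a B₁) :
    ∃ y, y ≠ [] ∧ (List.replicate K y).flatten <:+: B₁ := by
  obtain ⟨z, ys, rfl, hz, hlen, hys⟩ := exists_blocks (fun x : Σ i, X i => decide (x.1 = a)) B₁
  change ys.length = colorCount a _ at hlen
  rw [← hlen] at hK
  set p := colorCount a q with hp
  have hmem {x : Σ i, X i} (hx : x ∈ α ++ ((z ++ ys.flatten) ++ B₂) ++ β) : x ∈ q :=
    mem_of_mem_flatten_replicate (h.mem_iff.1 hx)
  -- All colors of `q` occur in `B₂`, so `τ` makes no further color available. The suffix of `B₁ ++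
  -- B₂` is lexicographically normal and starts with the largest color `a`, which leaves only `a`.
  have havail (i : ℕ) (hi : i < ys.length) (τ : List (Σ i, X i)) (hτ : ∀ x ∈ τ, x ∈ q) (c : J)
      (hc : Avail I c ((ys.drop i).flatten ++ B₂ ++ τ)) : c = a := by
    have hsplit : ys.flatten = (ys.take i).flatten ++ (ys.drop i).flatten := by
      rw [← List.flatten_append, List.take_append_drop]
    obtain ⟨x, hx, rfl⟩ := hc.exists_mem
    have hxq : x ∈ q := by
      rw [List.mem_append] at hx
      rcases hx with hx | hx
      · refine hmem ?_
        rw [hsplit]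
        simp only [List.mem_append] at hx ⊢
        tauto
      · exact hτ x hx
    obtain ⟨y, hy, hyx⟩ := hq x hxq
    have h1 := hc.of_append ⟨y, by simp [hy], hyx⟩
    have h2 : LexNormal I ((ys.drop i).flatten ++ B₂) := by
      rw [hsplit] at hB
      refine LexNormal.of_append_right (w := z ++ (ys.take i).flatten) ?_
      simpa using hB
    rw [List.drop_eq_getElem_cons hi, List.flatten_cons] at h1 h2
    obtain ⟨b, y', hb, hb', -⟩ := hys _ (List.getElem_mem hi)
    rw [hb] at h1 h2
    have h3 := h2.1 _ h1
    have hb' : b.1 = a := by simpa using hb'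
    exact (hmax x hxq).antisymm (hb' ▸ h3)
  -- Both sides are prefixes of the trace $q^{m+1}$ with the same number of letters `a`.
  have hshift (i : ℕ) (hi : i + p < ys.length) : TraceEq I (q ++ (α ++ z ++ (ys.take i).flatten))
      (α ++ z ++ (ys.take (i + p)).flatten) := by
    have hsplit (j : ℕ) : α ++ z ++ (ys.take j).flatten ++ ((ys.drop j).flatten ++ B₂ ++ β) =
        α ++ ((z ++ ys.flatten) ++ B₂) ++ β := by
      conv_rhs => rw [← List.take_append_drop j ys, List.flatten_append]
      simp
    have hcount (j : ℕ) (hj : j < ys.length) : colorCount a (ys.take j).flatten = j := by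
      refine (countP_flatten_blocks fun y hy => ?_).trans (by rw [List.length_take]; omega)
      obtain ⟨b, y', -, -, h1⟩ := hys y (List.mem_of_mem_take hy)
      exact h1
    refine TraceEq.prefix_unique (a := a) (v := (ys.drop i).flatten ++ B₂ ++ β)
      (v' := (ys.drop (i + p)).flatten ++ B₂ ++ (β ++ q)) ?_ ?_ (havail i (by omega) β ?_)
      (havail _ hi (β ++ q) ?_)
    · have e1 : q ++ (α ++ z ++ (ys.take i).flatten) ++ ((ys.drop i).flatten ++ B₂ ++ β) =
          q ++ (α ++ ((z ++ ys.flatten) ++ B₂) ++ β) := by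
        rw [← hsplit i]; simp
      have e2 : α ++ z ++ (ys.take (i + p)).flatten ++
          ((ys.drop (i + p)).flatten ++ B₂ ++ (β ++ q)) =
          (α ++ ((z ++ ys.flatten) ++ B₂) ++ β) ++ q := by
        rw [← hsplit (i + p)]; simp
      rw [e1, e2]
      refine (h.append_left q).trans (.trans ?_ (h.append_right q).symm)
      rw [← flatten_replicate_succ', List.replicate_succ, List.flatten_cons]
      exact .refl _
    · simp only [colorCount_append]
      rw [hcount i (by omega), hcount _ hi]
      omega
    · exact fun x hx => hmem (by simp [hx])
    · intro x hx
      rcases List.mem_append.1 hx with hx | hx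
      · exact hmem (by simp [hx])
      · exact hx
  have hlex (i : ℕ) (hi : i < ys.length) : LexNormal I ys[i] :=
    hB.of_append_left.of_append_right.of_infix (List.infix_of_mem_flatten (List.getElem_mem hi))
  -- Compare the shifts at `i` and `i + 1` and cancel. The second one needs `i + 1 + p < ys.length`,
  -- hence the strict inequality in `hK`. Equivalent blocks are equal as both are lexicographically
  -- normal.
  have hper (i : ℕ) (hi : i + p < K * p) : ys[i]? = ys[i + p]? := by
    have h1 := hshift i (by omega)
    have h2 := hshift (i + 1) (by omega)
    rw [List.take_succ_eq_append_getElem (by omega), show i + 1 + p = i + p + 1 by ring,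
      List.take_succ_eq_append_getElem (by omega)] at h2
    simp only [List.flatten_append, List.flatten_singleton, ← List.append_assoc] at h1 h2
    have h3 := ((h1.symm.append_right ys[i]).trans h2).of_append_left
    rw [List.getElem?_eq_getElem (by omega : i < ys.length),
      List.getElem?_eq_getElem (by omega : i + p < ys.length),
      (hlex i (by omega)).eq_of_traceEq (hlex (i + p) (by omega)) h3]
  have htake := take_mul_eq_of_periodic ys p K hK.le hper
  refine ⟨(ys.take p).flatten, ?_, ?_⟩
  · have hy : 0 < ys.length := by omega
    obtain ⟨b, y', hb, -⟩ := hys _ (List.getElem_mem hy)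
    intro h0
    have h1 := List.flatten_eq_nil_iff.1 h0 ys[0]
      (List.mem_take_iff_getElem.2 ⟨0, lt_min ha hy, rfl⟩)
    rw [hb] at h1
    exact absurd h1 (List.cons_ne_nil _ _)
  · have h1 : (List.replicate K (ys.take p).flatten).flatten = (ys.take (K * p)).flatten := by
      rw [htake, List.flatten_flatten, List.map_replicate]
    rw [h1]
    refine ⟨z, (ys.drop (K * p)).flatten, ?_⟩
    rw [List.append_assoc, ← List.flatten_append, List.take_append_drop]

/-- Cut off a prefix with `N` letters of color `a`. If one of its colors is missing in the rest, the
rest has fewer colors and the argument is repeated there, so `k + 1` portions suffice. -/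
theorem exists_stable_split {N : ℕ} (hN : 0 < N) (a : J) (k : ℕ) {B : List (Σ i, X i)}
    (hk : (B.map Sigma.fst).toFinset.card ≤ k) (hB : (k + 1) * N ≤ colorCount a B) :
    ∃ B₁ B₂, B₁ ++ B₂ <:+: B ∧ N ≤ colorCount a B₁ ∧ ∀ x ∈ B₁, ∃ y ∈ B₂, y.1 = x.1 := by
  induction k generalizing B with
  | zero =>
    have : B = [] := by simpa using hk
    subst this
    simp [colorCount] at hB
    omega
  | succ k ih =>
    have h0 : N ≤ colorCount a B := le_trans (Nat.le_mul_of_pos_left N (by omega)) hB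
    obtain ⟨B₁, B₂, rfl, h1⟩ := exists_split_countP (fun x : Σ i, X i => decide (x.1 = a)) h0
    change colorCount a B₁ = N at h1
    by_cases h2 : ∀ x ∈ B₁, ∃ y ∈ B₂, y.1 = x.1
    · exact ⟨B₁, B₂, List.infix_rfl, h1.ge, h2⟩
    push Not at h2
    obtain ⟨x, hx, h2⟩ := h2
    obtain ⟨C₁, C₂, h3, h4⟩ := ih (B := B₂) (by
      refine Nat.le_of_lt_succ (lt_of_lt_of_le (Finset.card_lt_card ?_) hk)
      refine Finset.ssubset_iff_subset_ne.2 ⟨fun c hc => ?_, fun h => ?_⟩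
      · rw [List.mem_toFinset] at hc ⊢; simp only [List.map_append, List.mem_append]; tauto
      · have : x.1 ∈ (B₂.map Sigma.fst).toFinset := by
          rw [h, List.mem_toFinset]; exact List.mem_map_of_mem (by simp [hx])
        rw [List.mem_toFinset, List.mem_map] at this
        obtain ⟨y, hy, hyx⟩ := this
        exact h2 y hy hyx) (by
      rw [colorCount_append, h1] at hB
      have : (k + 1 + 1) * N = (k + 1) * N + N := by ring
      omega)
    exact ⟨C₁, C₂, h3.trans (List.suffix_append B₁ B₂).isInfix, h4⟩

/-- Putting `x` back may break the factor `B` in two. The part with more letters of color `a` is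
kept, and the other one joins the context. -/
theorem exists_factor_of_delete (a : J) {W₁ W₂ Q α B β : List (Σ i, X i)} (x : Σ i, X i)
    (hB : B <:+: W₁ ++ W₂) (h : TraceEq I (α ++ B ++ β) Q) :
    ∃ B' α' β', B' <:+: W₁ ++ x :: W₂ ∧ TraceEq I (α' ++ B' ++ β') Q ∧
      colorCount a B ≤ 2 * colorCount a B' := by
  obtain ⟨s, t, hst⟩ := hB
  rcases List.append_eq_append_iff.1 hst with ⟨d, rfl, rfl⟩ | ⟨d, hd, rfl⟩
  · exact ⟨B, α, β, ⟨s, d ++ x :: W₂, by simp⟩, h, by omega⟩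
  rcases List.append_eq_append_iff.1 hd with ⟨e, rfl, rfl⟩ | ⟨e, rfl, rfl⟩
  · rw [colorCount_append]
    by_cases hle : colorCount a e ≤ colorCount a d
    · exact ⟨d, α ++ e, β, ⟨s ++ e ++ [x], t, by simp⟩, by simpa using h, by omega⟩
    · exact ⟨e, α, d ++ β, ⟨s, x :: (d ++ t), by simp⟩, by simpa using h, by omega⟩
  · exact ⟨B, α, β, ⟨W₁ ++ x :: e, t, by simp⟩, h, by omega⟩

/-- The letters of `s` and `t` are deleted from `W` one at a time; each of them at worst halves the
number of letters `a` in the factor. -/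
theorem exists_factor_of_traceEq (a : J) {s t Q W : List (Σ i, X i)}
    (h : TraceEq I (s ++ Q ++ t) W) :
    ∃ B α β, B <:+: W ∧ TraceEq I (α ++ B ++ β) Q ∧
      colorCount a Q ≤ 2 ^ (s.length + t.length) * colorCount a B := by
  induction hn : s.length + t.length generalizing s t W with
  | zero =>
    obtain ⟨h1, h2⟩ := Nat.add_eq_zero_iff.1 hn
    rw [List.length_eq_zero_iff] at h1 h2
    subst h1 h2
    simp only [List.nil_append, List.append_nil] at h
    exact ⟨W, [], [], List.infix_rfl, by simpa using h.symm, by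
      rw [pow_zero, one_mul]; exact (h.count_color a).le⟩
  | succ n ih =>
    have key : ∃ (s' t' W₁ W₂ : List (Σ i, X i)) (x : Σ i, X i), W = W₁ ++ x :: W₂ ∧
        TraceEq I (s' ++ Q ++ t') (W₁ ++ W₂) ∧ s'.length + t'.length = n := by
      cases s with
      | nil =>
        rcases List.eq_nil_or_concat t with rfl | ⟨t, x, rfl⟩
        · simp at hn
        · have h' : TraceEq I (([] ++ Q ++ t) ++ [x]) W := by simpa using h
          obtain ⟨W₁, W₂, rfl, -, h2⟩ := h'.exists_of_concat
          exact ⟨[], t, W₁, W₂, x, rfl, h2, by simpa using hn⟩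
      | cons x s =>
        obtain ⟨W₁, W₂, rfl, -, h2⟩ := TraceEq.exists_of_cons (w := s ++ Q ++ t) h
        exact ⟨s, t, W₁, W₂, x, rfl, h2, by rw [List.length_cons] at hn; omega⟩
    obtain ⟨s', t', W₁, W₂, x, rfl, h1, h2⟩ := key
    obtain ⟨B, α, β, h3, h4, h5⟩ := ih h1 h2
    obtain ⟨B', α', β', h6, h7, h8⟩ := exists_factor_of_delete a x h3 h4
    refine ⟨B', α', β', h6, h7, h5.trans ?_⟩
    rw [pow_succ, mul_assoc]
    exact Nat.mul_le_mul_left _ h8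

/-- The lexicographic normal forms of traces `s q ^ m t` contain high powers. -/
theorem exists_power_infix {q : List (Σ i, X i)} (hq : q ≠ []) (k K : ℕ) :
    ∃ m₀, ∀ m ≥ m₀, ∀ s t W : List (Σ i, X i), s.length + t.length ≤ k → LexNormal I W →
      TraceEq I (s ++ (List.replicate m q).flatten ++ t) W →
      ∃ y, y ≠ [] ∧ (List.replicate K y).flatten <:+: W := by
  obtain ⟨x₀, hx₀, hmax⟩ : ∃ x ∈ q, ∀ y ∈ q, y.1 ≤ x.1 := by
    obtain ⟨x, hx, h⟩ := Set.exists_max_image {x | x ∈ q} Sigma.fst (List.finite_toSet q)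
      (List.exists_mem_of_ne_nil q hq)
    exact ⟨x, hx, h⟩
  set a := x₀.1
  set C := (q.map Sigma.fst).toFinset.card
  set N := K * colorCount a q + 1
  have ha : 0 < colorCount a q := colorCount_pos.2 ⟨x₀, hx₀, rfl⟩
  -- The factor `2 ^ k` pays for the deletion of `s` and `t`, and `C + 1` for the loss of colors in
  -- `exists_stable_split`. The `+ 1` in `N` gives the strict inequality required by
  -- `exists_power_of_factor`.
  refine ⟨2 ^ k * ((C + 1) * N), fun m hm s t W hst hW h => ?_⟩
  obtain ⟨B, α, β, hB, hαβ, hcount⟩ := exists_factor_of_traceEq a h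
  have hBq : ∀ x ∈ B, x ∈ q := fun x hx =>
    mem_of_mem_flatten_replicate (hαβ.mem_iff.1 (by simp [hx]))
  rw [colorCount_flatten_replicate] at hcount
  have hN : (C + 1) * N ≤ colorCount a B := by
    have h1 : 2 ^ k * ((C + 1) * N) ≤ 2 ^ k * colorCount a B :=
      calc 2 ^ k * ((C + 1) * N) ≤ m := hm
        _ ≤ m * colorCount a q := Nat.le_mul_of_pos_right m ha
        _ ≤ _ := hcount
        _ ≤ _ := Nat.mul_le_mul_right _ (Nat.pow_le_pow_right (by norm_num) hst)
    exact Nat.le_of_mul_le_mul_left h1 (by positivity)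
  obtain ⟨B₁, B₂, hB', hN', hcol⟩ := exists_stable_split (N := N) (Nat.succ_pos _) a C (B := B)
    (Finset.card_le_card fun c hc => by
      rw [List.mem_toFinset, List.mem_map] at *
      obtain ⟨x, hx, rfl⟩ := hc
      exact ⟨x, hBq x hx, rfl⟩) hN
  obtain ⟨s', t', rfl⟩ := hB'
  have hW' : LexNormal I (B₁ ++ B₂) := (hW.of_infix hB).of_infix ⟨s', t', rfl⟩
  -- Colors of `q` that are missing in `B₂` are erased everywhere. This leaves `B₁ ++ B₂` unchanged
  -- and turns the power of `q` into a power of the filtered word.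
  let D : J → Bool := fun c => decide (∃ y ∈ B₂, y.1 = c)
  have hfilter : (B₁ ++ B₂).filter (fun x => D x.1) = B₁ ++ B₂ := by
    rw [List.filter_eq_self]
    intro x hx
    rcases List.mem_append.1 hx with hx | hx
    · exact decide_eq_true (hcol x hx)
    · exact decide_eq_true ⟨x, hx, rfl⟩
  have hD := hαβ.filter D
  rw [List.filter_flatten, List.map_replicate] at hD
  have e : (α ++ (s' ++ (B₁ ++ B₂) ++ t') ++ β).filter (fun x => D x.1) =
      (α ++ s').filter (fun x => D x.1) ++ (B₁ ++ B₂) ++ (t' ++ β).filter (fun x => D x.1) := by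
    conv_rhs => rw [← hfilter]
    simp only [List.filter_append, List.append_assoc]
  rw [e] at hD
  have haD : ∃ y ∈ B₂, y.1 = a := by
    obtain ⟨x, hx, hxa⟩ := colorCount_pos.1 (lt_of_lt_of_le (Nat.succ_pos _) hN')
    obtain ⟨y, hy, hyx⟩ := hcol x hx
    exact ⟨y, hy, hyx.trans hxa⟩
  have hqa : colorCount a (q.filter fun x => D x.1) = colorCount a q := by
    unfold colorCount
    rw [List.countP_filter]
    refine List.countP_congr fun x _ => ?_
    simp only [Bool.and_eq_true, decide_eq_true_eq, and_iff_left_iff_imp]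
    intro hx
    exact decide_eq_true (hx ▸ haD)
  obtain ⟨y, hy, hy'⟩ := exists_power_of_factor (K := K) hD hW'
    (fun x hx => of_decide_eq_true (List.mem_filter.1 hx).2)
    (fun x hx => hmax x (List.mem_filter.1 hx).1) (hqa ▸ ha) (by rw [hqa]; omega)
  exact ⟨y, hy, (hy'.trans (List.prefix_append B₁ B₂).isInfix).trans
    (List.IsInfix.trans ⟨s', t', rfl⟩ hB)⟩

end Power

/-! ### Reduced powers and cyclically reduced words -/

section Reverse

variable {J : Type*} [DecidableEq J] {X : J → Type*} {I : SimpleGraph J}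
  {w v : List (Σ i, X i)}

theorem Reduced.reverse (h : Reduced I w) : Reduced I w.reverse := by
  by_contra hn
  obtain ⟨e, x, f, y, g, h1, h2, h3⟩ := exists_pair_of_not_reduced hn
  rw [← List.reverse_inj, List.reverse_reverse] at h1
  rw [h1] at h
  refine Reduced.not_of_pair (e := g.reverse) (x := y) (f := f.reverse) (y := x) (g := e.reverse)
    (by simpa using h) h2.symm ?_
  simpa [h2] using h3

/-- A letter of `s` could merge with one of `r` only by passing over all of `q`, which contains a
letter dependent on it. -/
theorem Reduced.glue {s q r : List (Σ i, X i)} (h₁ : Reduced I (s ++ q)) (h₂ : Reduced I (q ++ r))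
    (hs : ∀ x ∈ s, ∃ z ∈ q, ¬ I.Adj z.1 x.1) : Reduced I (s ++ (q ++ r)) := by
  induction s with
  | nil => exact h₂
  | cons a s ih =>
    simp only [List.mem_cons, forall_eq_or_imp] at hs
    refine ⟨fun hc => ?_, ih h₁.2 hs.2⟩
    replace hc : Avail I a.1 (s ++ (q ++ r)) := hc
    rw [← List.append_assoc, avail_append_iff] at hc
    rcases hc with hc | ⟨hc, -⟩
    · exact h₁.1 hc
    · obtain ⟨z, hz, hza⟩ := hs.1
      exact hza (hc z (by simp [hz]))

theorem Reduced.flatten_replicate {q : List (Σ i, X i)} (h : Reduced I (q ++ q)) (n : ℕ) :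
    Reduced I (List.replicate n q).flatten := by
  have key (n : ℕ) : Reduced I (List.replicate (n + 1) q).flatten := by
    induction n with
    | zero => simpa using h.of_append_left
    | succ n ih =>
      rw [flatten_replicate_succ'] at ih
      rw [flatten_replicate_succ', flatten_replicate_succ', List.append_assoc]
      exact ih.glue h fun x hx => ⟨x, mem_of_mem_flatten_replicate hx, I.loopless.irrefl _⟩
  cases n with
  | zero => trivial
  | succ n => exact key n

theorem TraceEq.partition (p : (Σ i, X i) → Bool)
    (h : ∀ x ∈ w, p x → ∀ z ∈ w, ¬ p z → I.Adj x.1 z.1) :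
    TraceEq I w (w.filter p ++ w.filter fun x => !p x) := by
  induction w with
  | nil => exact .refl _
  | cons x w ih =>
    have ih := ih fun y hy h1 z hz h2 => h y (by simp [hy]) h1 z (by simp [hz]) h2
    by_cases hx : p x
    · rw [List.filter_cons_of_pos hx, List.filter_cons_of_neg (by simpa using hx)]
      exact ih.cons x
    · rw [List.filter_cons_of_neg hx, List.filter_cons_of_pos (by simpa using hx)]
      refine (ih.cons x).trans (TraceEq.move (fun z hz => ?_) _).symm
      obtain ⟨hz1, hz2⟩ := List.mem_filter.1 hz
      exact h z (by simp [hz1]) hz2 x (by simp) hx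

theorem avail_of_mem {c : J} (h : ∀ z ∈ w, z.1 ≠ c → I.Adj z.1 c) (hc : ∃ z ∈ w, z.1 = c) :
    Avail I c w := by
  induction w with
  | nil => simp at hc
  | cons a w ih =>
    by_cases ha : a.1 = c
    · exact Or.inl ha
    · refine Or.inr ⟨h a (by simp) ha, ih (fun z hz => h z (by simp [hz])) ?_⟩
      obtain ⟨z, hz, rfl⟩ := hc
      rcases List.mem_cons.1 hz with rfl | hz
      · exact absurd rfl ha
      · exact ⟨z, hz, rfl⟩

open Classical in
/-- A reduced word whose first and last letters cannot be brought to have the same color splits into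
pairwise independent letters and a word all of whose powers are reduced. -/
theorem Reduced.exists_split_of_cyclically_reduced (hw : Reduced I w)
    (h : ∀ x y v, x.1 = y.1 → ¬ TraceEq I w (x :: (v ++ [y]))) :
    ∃ u q, TraceEq I w (u ++ q) ∧ u.Pairwise (fun a b => I.Adj a.1 b.1) ∧
      (∀ a ∈ u, ∀ b ∈ q, I.Adj a.1 b.1) ∧ ∀ n, Reduced I (List.replicate n q).flatten := by
  -- The word `u` collects the letters whose color is independent of all other colors of `w`.
  let P : J → Prop := fun c => ∀ z ∈ w, z.1 ≠ c → I.Adj z.1 c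
  let p : (Σ i, X i) → Bool := fun x => decide (P x.1)
  have hP : ∀ x ∈ w, P x.1 → ∀ z ∈ w, ¬ P z.1 → I.Adj x.1 z.1 := by
    intro x _ hx z hz hz'
    exact (hx z hz fun h => hz' (h ▸ hx)).symm
  have hpart : TraceEq I w (w.filter p ++ w.filter fun x => !p x) :=
    TraceEq.partition p fun x hx h1 z hz h2 =>
      hP x hx (of_decide_eq_true h1) z hz fun h => h2 (decide_eq_true h)
  have hu : ∀ x ∈ w.filter p, x ∈ w ∧ P x.1 := fun x hx =>
    ⟨(List.mem_filter.1 hx).1, of_decide_eq_true (List.mem_filter.1 hx).2⟩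
  have hq : ∀ x ∈ w.filter fun x => !p x, x ∈ w ∧ ¬ P x.1 := fun x hx =>
    ⟨(List.mem_filter.1 hx).1, by simpa [p] using (List.mem_filter.1 hx).2⟩
  have hr := hw.congr hpart
  generalize w.filter p = u at hpart hu hr
  generalize (w.filter fun x => !p x) = q at hpart hq hr
  have huq : ∀ a ∈ u, ∀ b ∈ q, I.Adj a.1 b.1 := fun a ha b hb =>
    hP a (hu a ha).1 (hu a ha).2 b (hq b hb).1 (hq b hb).2
  refine ⟨u, q, hpart, ?_, huq, Reduced.flatten_replicate ?_⟩
  · have hur := hr.of_append_left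
    clear hpart hr huq
    induction u with
    | nil => exact List.Pairwise.nil
    | cons a u ih =>
      refine List.Pairwise.cons (fun b hb => ?_) (ih (fun x hx => hu x (by simp [hx])) hur.2)
      have ha := (hu a (by simp)).2
      have hz : ∀ z ∈ u, z.1 ≠ a.1 → I.Adj z.1 a.1 := fun z hz => ha z (hu z (by simp [hz])).1
      exact (hz b hb fun hba => hur.1 (avail_of_mem hz ⟨b, hb, hba⟩)).symm
  · by_contra hn
    have hqr := hr.of_append_right
    obtain ⟨e, x, e', f, y, f', h1, h2, h3, h4, h5⟩ := not_reduced_append hqr hqr hn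
    have hxq : x ∈ q := by rw [h1]; simp
    have hnot : ¬ ((∀ z ∈ e, I.Adj z.1 x.1) ∧ ∀ z ∈ e', I.Adj z.1 x.1) := by
      rintro ⟨he, he'⟩
      refine (hq x hxq).2 fun z hz hzx => ?_
      rw [hpart.mem_iff, h1] at hz
      simp only [List.mem_append, List.mem_cons] at hz
      rcases hz with hz | hz | rfl | hz
      · exact huq z hz x hxq
      · exact he z hz
      · exact absurd rfl hzx
      · exact he' z hz
    -- If `y` stands before `x` in `q`, then `y` moves to the front of `w` and `x` to the end, which
    -- is excluded by `h`. Otherwise `f` covers `e`, and the color of `x` is independent of all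
    -- others, so `x` would belong to `u`.
    rcases List.append_eq_append_iff.1 (h1.symm.trans h2) with ⟨d, rfl, hd⟩ | ⟨d, rfl, hd⟩
    · exact hnot ⟨fun z hz => h5 z (by simp [hz]), h4⟩
    · cases d with
      | nil => exact hnot ⟨by simpa using h5, h4⟩
      | cons b d =>
        rw [List.cons_append] at hd
        obtain ⟨rfl, rfl⟩ := List.cons.inj hd
        refine h y x (u ++ (f ++ d ++ e')) h3.symm (hpart.trans ?_)
        rw [h2]
        have m1 : TraceEq I (u ++ (f ++ y :: (d ++ x :: e')))
            (y :: (u ++ f ++ (d ++ x :: e'))) := by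
          rw [← List.append_assoc]
          refine TraceEq.move (fun z hz => ?_) _
          rcases List.mem_append.1 hz with hz | hz
          · rw [← h3]; exact huq z hz x hxq
          · rw [← h3]; exact h5 z hz
        have m2 : TraceEq I (u ++ f ++ (d ++ x :: e')) (u ++ (f ++ d ++ e') ++ [x]) := by
          simpa using TraceEq.move_last h4 (u ++ f ++ d)
        exact m1.trans (m2.cons y)

end Reverse

/-! ### Induction up to rotation -/

section Cyclic

variable {J : Type*} [DecidableEq J] {I : SimpleGraph J} {M : J → Type*} [∀ i, Monoid (M i)]

theorem exists_eval_eq (x : GraphProduct I M) : ∃ w, eval I M w = x := by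
  obtain ⟨u, rfl⟩ := psi_surjective I M x
  obtain ⟨w, rfl⟩ := toTrace_surjective _ u
  exact ⟨w.toList, (psi_toTrace I M w.toList).symm⟩

theorem length_consLocal_le {i : J} (m : M i) (w : List (BigLetter M)) :
    (consLocal m w).length ≤ w.length + 1 := by
  by_cases h : m = 1
  · subst h; simp
  · rw [consLocal_of_ne h, List.length_cons]

theorem exists_shorter_of_not_reduced {w : List (BigLetter M)} (h : ¬ Reduced I w) :
    ∃ v, v.length < w.length ∧ eval I M v = eval I M w := by
  obtain ⟨e, ⟨i, x⟩, f, ⟨j, y⟩, g, rfl, h1, h2⟩ := exists_pair_of_not_reduced h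
  obtain rfl : j = i := h1
  refine ⟨e ++ consLocal (x.1 * y.1) (f ++ g), ?_, ?_⟩
  · have := length_consLocal_le (x.1 * y.1) (f ++ g)
    simp only [List.length_append, List.length_cons] at *
    omega
  · have := (((TraceEq.move (x := ⟨j, y⟩) h2 g).cons ⟨j, x⟩).append_left e).eval_eq
    rw [this, eval_append, eval_consLocal, map_mul]
    simp [mul_assoc]

/-- Up to rotation, every element of the graph product is a product of pairwise independent letters
and of an element all of whose powers are reduced. -/
theorem cyclic_induction {P : GraphProduct I M → Prop} (hrot : ∀ x y, P (y * x) → P (x * y))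
    (hbase : ∀ u q : List (BigLetter M), u.Pairwise (fun a b => I.Adj a.1 b.1) →
      (∀ a ∈ u, ∀ b ∈ q, I.Adj a.1 b.1) → (∀ n, Reduced I (List.replicate n q).flatten) →
      P (eval I M u * eval I M q)) (x : GraphProduct I M) : P x := by
  obtain ⟨w, rfl⟩ := exists_eval_eq x
  induction hn : w.length using Nat.strong_induction_on generalizing w with
  | _ n ih =>
    subst hn
    by_cases hw : Reduced I w
    · by_cases h : ∀ x y v, x.1 = y.1 → ¬ TraceEq I w (x :: (v ++ [y]))
      · obtain ⟨u, q, h1, h2, h3, h4⟩ := hw.exists_split_of_cyclically_reduced h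
        rw [h1.eval_eq, eval_append]
        exact hbase u q h2 h3 h4
      · push Not at h
        obtain ⟨⟨i, x⟩, ⟨j, y⟩, v, hij, h⟩ := h
        obtain rfl : i = j := hij
        rw [h.eval_eq, ← List.cons_append, eval_append]
        -- Rotation brings the last letter next to the first one, which has the same color; merging
        -- them shortens the word.
        refine hrot _ _ ?_
        have := ih (m := (consLocal (y.1 * x.1) v).length) (by
          rw [h.length_eq]
          refine (length_consLocal_le _ _).trans_lt ?_
          simp) _ rfl
        rw [eval_consLocal, map_mul] at this
        simpa [mul_assoc] using this
    · obtain ⟨v, h1, h2⟩ := exists_shorter_of_not_reduced hw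
      rw [← h2]
      exact ih _ h1 v rfl

end Cyclic

/-! ### Words close to a power -/

section Near

variable {J : Type*} [DecidableEq J] {X : J → Type*} {I : SimpleGraph J}
  {w v q : List (Σ i, X i)}

/-- Up to trace equivalence, the word is a power of `q` with exponent at least `m`, surrounded by
words of total length at most `k`. -/
def NearPower (I : SimpleGraph J) (q : List (Σ i, X i)) (k m : ℕ) (w : List (Σ i, X i)) : Prop :=
  ∃ (s t : List (Σ i, X i)) (n : ℕ), s.length + t.length ≤ k ∧ m ≤ n ∧
    TraceEq I (s ++ (List.replicate n q).flatten ++ t) w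

theorem NearPower.congr {k m : ℕ} (h : NearPower I q k m w) (hv : TraceEq I w v) :
    NearPower I q k m v := by
  obtain ⟨s, t, n, h1, h2, h3⟩ := h
  exact ⟨s, t, n, h1, h2, h3.trans hv⟩

theorem NearPower.mono {k k' m m' : ℕ} (h : NearPower I q k m w) (hk : k ≤ k') (hm : m' ≤ m) :
    NearPower I q k' m' w := by
  obtain ⟨s, t, n, h1, h2, h3⟩ := h
  exact ⟨s, t, n, h1.trans hk, hm.trans h2, h3⟩

theorem NearPower.reverse {k m : ℕ} (h : NearPower I q k m w) :
    NearPower I q.reverse k m w.reverse := by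
  obtain ⟨s, t, n, h1, h2, h3⟩ := h
  refine ⟨t.reverse, s.reverse, n, by simpa [add_comm] using h1, h2, ?_⟩
  have := h3.reverse
  rwa [List.reverse_append, List.reverse_append, List.reverse_flatten, List.map_replicate,
    List.reverse_replicate, ← List.append_assoc] at this

theorem NearPower.cons {k m : ℕ} (h : NearPower I q k m w) (x : Σ i, X i) :
    NearPower I q (k + 1) m (x :: w) := by
  obtain ⟨s, t, n, h1, h2, h3⟩ := h
  exact ⟨x :: s, t, n, by rw [List.length_cons]; omega, h2, h3.cons x⟩

theorem append_eq_append_cons {A : Type*} {a b v₁ v₂ : List A} {x : A}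
    (h : a ++ b = v₁ ++ x :: v₂) :
    (∃ a₂, a = v₁ ++ x :: a₂ ∧ v₂ = a₂ ++ b) ∨ ∃ b₁, v₁ = a ++ b₁ ∧ b = b₁ ++ x :: v₂ := by
  rcases List.append_eq_append_iff.1 h with ⟨d, rfl, rfl⟩ | ⟨d, rfl, h'⟩
  · exact Or.inr ⟨d, rfl, rfl⟩
  · cases d with
    | nil => exact Or.inr ⟨[], by simp, h'.symm⟩
    | cons y d =>
      rw [List.cons_append] at h'
      obtain ⟨rfl, rfl⟩ := List.cons.inj h'
      exact Or.inl ⟨d, rfl, rfl⟩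

/-- The removed letter comes from `s`, from the first copy of `q`, whose remainder is then absorbed
into `s`, or from `t`. It cannot come from a later copy, since it would have to pass its own color
in the first one. -/
theorem NearPower.of_cons {k m : ℕ} {x : Σ i, X i} (h : NearPower I q k (m + 1) (x :: w)) :
    NearPower I q (k + q.length) m w := by
  obtain ⟨s, t, n, h1, h2, h3⟩ := h
  obtain ⟨n, rfl⟩ : ∃ n', n = n' + 1 := ⟨n - 1, by omega⟩
  obtain ⟨v₁, v₂, h4, h5, h6⟩ := h3.symm.exists_of_cons
  rw [List.append_assoc, List.replicate_succ, List.flatten_cons, List.append_assoc] at h4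
  rcases append_eq_append_cons h4 with ⟨s₂, rfl, rfl⟩ | ⟨b, rfl, h7⟩
  · refine ⟨v₁ ++ s₂, t, n + 1, ?_, by omega, .trans ?_ h6.symm⟩
    · simp only [List.length_append, List.length_cons] at *; omega
    · rw [List.replicate_succ, List.flatten_cons]
      simpa using .refl _
  rcases append_eq_append_cons h7 with ⟨q₂, rfl, rfl⟩ | ⟨b, rfl, h8⟩
  · refine ⟨s ++ b ++ q₂, t, n, ?_, by omega, .trans ?_ h6.symm⟩
    · simp only [List.length_append, List.length_cons] at *; omega
    · simpa using .refl _
  rcases append_eq_append_cons h8 with ⟨r, h9, -⟩ | ⟨b, rfl, rfl⟩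
  · have hx : x ∈ q := mem_of_mem_flatten_replicate (n := n) (by rw [h9]; simp)
    exact absurd (h5 x (by simp [hx])) (I.loopless.irrefl _)
  · refine ⟨s, b ++ v₂, n + 1, ?_, by omega, .trans ?_ h6.symm⟩
    · simp only [List.length_append, List.length_cons] at *; omega
    · rw [List.replicate_succ, List.flatten_cons]
      simpa using .refl _

end Near

/-! ### Multiplication by local elements -/

section Multiplication

variable {J : Type*} [DecidableEq J] {I : SimpleGraph J} {M : J → Type*} [∀ i, Monoid (M i)]
  {q : List (BigLetter M)}

/-- Removing the old letter costs at most one copy of `q`, adding `q.length` to the context; the new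
letter adds `1`. -/
theorem NearPower.of_consLocal {k m : ℕ} {i : J} {x : M i} {v : List (BigLetter M)}
    (h : NearPower I q k (m + 1) (consLocal x v)) (y : M i) :
    NearPower I q (k + (q.length + 1)) m (consLocal y v) := by
  have hv : NearPower I q (k + q.length) m v := by
    by_cases hx : x = 1
    · subst hx
      exact (by simpa using h : NearPower I q k (m + 1) v).mono (by omega) (by omega)
    · rw [consLocal_of_ne hx] at h
      exact h.of_cons
  by_cases hy : y = 1
  · subst hy
    rw [consLocal_one]
    exact hv.mono (by omega) le_rfl
  · rw [consLocal_of_ne hy]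
    exact (hv.cons _).mono (by omega) le_rfl

variable (I M) in
/-- The product in the graph product of elements of local monoids. -/
def evalLocal (l : List (Σ i, M i)) : GraphProduct I M := (l.map fun a => ofLocal I M a.1 a.2).prod

@[simp] theorem evalLocal_nil : evalLocal I M [] = 1 := rfl

@[simp] theorem evalLocal_cons (a : Σ i, M i) (l : List (Σ i, M i)) :
    evalLocal I M (a :: l) = ofLocal I M a.1 a.2 * evalLocal I M l := by simp [evalLocal]

@[simp] theorem evalLocal_append (l l' : List (Σ i, M i)) :
    evalLocal I M (l ++ l') = evalLocal I M l * evalLocal I M l' := by simp [evalLocal]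

theorem eval_eq_evalLocal (w : List (BigLetter M)) :
    eval I M w = evalLocal I M (w.map fun a => ⟨a.1, a.2.1⟩) := by
  simp [eval, evalLocal, Function.comp_def]

theorem eval_reverse_consLocal {i : J} (m : M i) (v : List (BigLetter M)) :
    eval I M (consLocal m v).reverse = eval I M v.reverse * ofLocal I M i m := by
  by_cases h : m = 1
  · subst h; simp
  · simp [consLocal_of_ne h]

theorem NearPower.exists_mul_left {k m : ℕ} {w : List (BigLetter M)} (hw : Reduced I w)
    (l : List (Σ i, M i)) (h : NearPower I q k (m + l.length) w) :
    ∃ w', Reduced I w' ∧ eval I M w' = evalLocal I M l * eval I M w ∧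
      NearPower I q (k + l.length * (q.length + 1)) m w' := by
  induction l generalizing m with
  | nil => exact ⟨w, hw, by simp, by simpa using h⟩
  | cons a l ih =>
    obtain ⟨w', h1, h2, h3⟩ := ih (m := m + 1) (h.mono le_rfl (by rw [List.length_cons]; omega))
    obtain ⟨x, v, hv, hi, hxv⟩ := h1.exists_consLocal a.1
    refine ⟨consLocal (a.2 * x) v, hv.consLocal _ hi, ?_, ?_⟩
    · rw [eval_consLocal, evalLocal_cons, mul_assoc, ← h2, hxv.eval_eq, eval_consLocal, map_mul,
        mul_assoc]
    · refine ((h3.congr hxv).of_consLocal (a.2 * x)).mono (le_of_eq ?_) le_rfl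
      rw [List.length_cons]; ring

theorem NearPower.exists_mul_right {k m : ℕ} {w : List (BigLetter M)} (hw : Reduced I w)
    (l : List (Σ i, M i)) (h : NearPower I q k (m + l.length) w) :
    ∃ w', Reduced I w' ∧ eval I M w' = eval I M w * evalLocal I M l ∧
      NearPower I q (k + l.length * (q.length + 1)) m w' := by
  induction l using List.reverseRecOn generalizing m with
  | nil => exact ⟨w, hw, by simp, by simpa using h⟩
  | append_singleton l a ih =>
    rw [List.length_append, List.length_singleton] at h
    obtain ⟨w', h1, h2, h3⟩ := ih (m := m + 1) (h.mono le_rfl (by omega))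
    obtain ⟨x, v, hv, hi, hxv⟩ := h1.reverse.exists_consLocal a.1
    have hxv' := hxv.reverse
    rw [List.reverse_reverse] at hxv'
    refine ⟨(consLocal (x * a.2) v).reverse, (hv.consLocal _ hi).reverse, ?_, ?_⟩
    · rw [eval_reverse_consLocal, evalLocal_append, ← mul_assoc, ← h2, hxv'.eval_eq,
        eval_reverse_consLocal, map_mul, evalLocal_cons, evalLocal_nil, mul_one, mul_assoc]
    · have h4 := ((h3.reverse.congr hxv).of_consLocal (x * a.2)).reverse
      rw [List.reverse_reverse, List.length_reverse] at h4
      refine h4.mono (le_of_eq ?_) le_rfl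
      rw [List.length_append, List.length_singleton]; ring

theorem eval_flatten_replicate (n : ℕ) (q : List (BigLetter M)) :
    eval I M (List.replicate n q).flatten = eval I M q ^ n := by
  induction n with
  | zero => simp
  | succ n ih => rw [flatten_replicate_succ', eval_append, ih, pow_succ]

theorem eval_commute {u v : List (BigLetter M)} (h : ∀ a ∈ u, ∀ b ∈ v, I.Adj a.1 b.1) :
    Commute (eval I M u) (eval I M v) := by
  have := (TraceEq.comm h).eval_eq
  rwa [eval_append, eval_append] at this

theorem eval_pow_of_pairwise {u : List (BigLetter M)}
    (h : u.Pairwise fun a b => I.Adj a.1 b.1) (n : ℕ) :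
    eval I M u ^ n = evalLocal I M (u.map fun a => ⟨a.1, a.2.1 ^ n⟩) := by
  induction u with
  | nil => simp
  | cons a u ih =>
    obtain ⟨h1, h2⟩ := List.pairwise_cons.1 h
    have hc : Commute (eval I M [a]) (eval I M u) := eval_commute (by simpa using h1)
    have e : eval I M (a :: u) = eval I M [a] * eval I M u := by simp
    rw [e, hc.mul_pow, ih h2]
    simp

end Multiplication

/-! ### Exponents tend to infinity for nonempty $q$ -/

section PowerCase

variable {J : Type*} [LinearOrder J] {I : SimpleGraph J} {M : J → Type*} [∀ i, Monoid (M i)]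
  {Γ : J → Type*} [∀ i, LinearOrder (Γ i)] {nf : ∀ i, M i → FreeMonoid (Γ i)}

/-- Whatever `n` is, the power $u^n$ is a product of `u.length` local elements. So the reduced word
stays within a distance of a power of `q` that does not depend on `n`. -/
theorem exists_le_expWord_globalNF (hnf : ∀ i m, m ≠ 1 → nf i m ≠ 1) {u q : List (BigLetter M)}
    (hu : u.Pairwise fun a b => I.Adj a.1 b.1) (huq : ∀ a ∈ u, ∀ b ∈ q, I.Adj a.1 b.1)
    (hq : ∀ n, Reduced I (List.replicate n q).flatten) (hq0 : q ≠ []) (x y : GraphProduct I M)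
    (K : ℕ) : ∃ n₀, ∀ n ≥ n₀,
      K ≤ expWord (globalNF I M nf (x * (eval I M u * eval I M q) ^ n * y)) := by
  obtain ⟨s, rfl⟩ := exists_eval_eq x
  obtain ⟨t, rfl⟩ := exists_eval_eq y
  set k := (s.length + u.length) * (q.length + 1) + t.length * (q.length + 1) with hk
  obtain ⟨m₀, hm₀⟩ := exists_power_infix (I := I) hq0 k K
  -- Each multiplication by a local element costs one copy of `q`.
  refine ⟨m₀ + (s.length + u.length) + t.length, fun n hn => ?_⟩
  have h0 : NearPower I q 0 (m₀ + (s.length + u.length) + t.length)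
      (List.replicate n q).flatten := ⟨[], [], n, by simp, hn, by simpa using .refl _⟩
  obtain ⟨w₁, h1, h2, h3⟩ := NearPower.exists_mul_right (q := q) (k := 0)
    (m := m₀ + (s.length + u.length)) (hq n)
    (t.map fun a : BigLetter M => (⟨a.1, a.2.1⟩ : Σ i, M i)) (by rwa [List.length_map])
  obtain ⟨w₂, h4, h5, h6⟩ := NearPower.exists_mul_left (m := m₀) h1
    ((s.map fun a : BigLetter M => (⟨a.1, a.2.1⟩ : Σ i, M i)) ++
      u.map fun a : BigLetter M => (⟨a.1, a.2.1 ^ n⟩ : Σ i, M i))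
    (by simpa using h3)
  have heval : eval I M w₂ = eval I M s * (eval I M u * eval I M q) ^ n * eval I M t := by
    rw [h5, h2, evalLocal_append, ← eval_eq_evalLocal, ← eval_eq_evalLocal,
      ← eval_pow_of_pairwise hu, eval_flatten_replicate, (eval_commute huq).mul_pow]
    simp only [mul_assoc]
  obtain ⟨w, hw1, hw2, hw3, hw4⟩ := exists_globalNF_eq hnf
    (eval I M s * (eval I M u * eval I M q) ^ n * eval I M t)
  have hw := h4.traceEq_of_eval_eq hw2 (heval.trans hw3.symm)
  obtain ⟨s', t', m, hm1, hm2, hm3⟩ := h6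
  obtain ⟨z, hz, hz'⟩ := hm₀ m hm2 s' t' w (by
    simp only [List.length_append, List.length_map] at hm1
    omega) hw1 (hm3.trans hw)
  rw [hw4]
  exact le_expWord_flatNF hnf hz hz'

end PowerCase

/-! ### Products of families of independent local elements -/

section Family

variable {J : Type*} [DecidableEq J] {I : SimpleGraph J} {M : J → Type*} [∀ i, Monoid (M i)]

variable (I M) in
/-- The product in the graph product of a family of elements of local monoids. -/
def evalFamily (D : List J) (b : ∀ i, M i) : GraphProduct I M :=
  evalLocal I M (D.map fun i => ⟨i, b i⟩)

@[simp] theorem evalFamily_nil (b : ∀ i, M i) : evalFamily I M [] b = 1 := rfl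

@[simp] theorem evalFamily_cons (i : J) (D : List J) (b : ∀ i, M i) :
    evalFamily I M (i :: D) b = ofLocal I M i (b i) * evalFamily I M D b := by simp [evalFamily]

@[simp] theorem evalFamily_append (D E : List J) (b : ∀ i, M i) :
    evalFamily I M (D ++ E) b = evalFamily I M D b * evalFamily I M E b := by simp [evalFamily]

theorem evalFamily_congr {D : List J} {b c : ∀ i, M i} (h : ∀ i ∈ D, b i = c i) :
    evalFamily I M D b = evalFamily I M D c := by
  unfold evalFamily
  congr 1
  exact List.map_congr_left fun i hi => by rw [h i hi]

theorem commute_evalFamily {i : J} {D : List J} (h : ∀ j ∈ D, I.Adj i j) (m : M i)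
    (b : ∀ i, M i) : Commute (ofLocal I M i m) (evalFamily I M D b) := by
  induction D with
  | nil => exact Commute.one_right _
  | cons j D ih =>
    rw [evalFamily_cons]
    exact Commute.mul_right (ofLocal_comm I M (h j (by simp)) m (b j))
      (ih fun k hk => h k (by simp [hk]))

theorem evalFamily_update_of_not_mem {i : J} {D : List J} (h : i ∉ D) (m : M i) (b : ∀ i, M i) :
    evalFamily I M D (Function.update b i m) = evalFamily I M D b :=
  evalFamily_congr fun j hj => Function.update_of_ne (by rintro rfl; exact h hj) _ _

theorem ofLocal_mul_evalFamily {i : J} {D : List J} (hD : D.Pairwise I.Adj) (hi : i ∈ D) (m : M i)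
    (b : ∀ i, M i) : ofLocal I M i m * evalFamily I M D b =
      evalFamily I M D (Function.update b i (m * b i)) := by
  induction D with
  | nil => simp at hi
  | cons j D ih =>
    obtain ⟨h1, h2⟩ := List.pairwise_cons.1 hD
    rw [evalFamily_cons, evalFamily_cons]
    by_cases hij : i = j
    · subst hij
      rw [evalFamily_update_of_not_mem fun h => I.loopless.irrefl _ (h1 i h),
        Function.update_self, map_mul, mul_assoc]
    · have hiD : i ∈ D := (List.mem_cons.1 hi).resolve_left hij
      rw [← ih h2 hiD, Function.update_of_ne (Ne.symm hij), ← mul_assoc, ← mul_assoc,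
        ofLocal_comm I M (h1 i hiD).symm]

theorem evalFamily_mul_ofLocal {i : J} {D : List J} (hD : D.Pairwise I.Adj) (hi : i ∈ D) (m : M i)
    (b : ∀ i, M i) : evalFamily I M D b * ofLocal I M i m =
      evalFamily I M D (Function.update b i (b i * m)) := by
  induction D with
  | nil => simp at hi
  | cons j D ih =>
    obtain ⟨h1, h2⟩ := List.pairwise_cons.1 hD
    rw [evalFamily_cons, evalFamily_cons]
    by_cases hij : i = j
    · subst hij
      rw [evalFamily_update_of_not_mem fun h => I.loopless.irrefl _ (h1 i h),
        Function.update_self, map_mul, mul_assoc, mul_assoc, (commute_evalFamily h1 m b).eq]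
    · have hiD : i ∈ D := (List.mem_cons.1 hi).resolve_left hij
      rw [mul_assoc, ih h2 hiD, Function.update_of_ne (Ne.symm hij)]

theorem exists_evalFamily_pow {u : List (BigLetter M)}
    (hu : u.Pairwise fun a b => I.Adj a.1 b.1) : ∃ (D : List J) (a : ∀ i, M i),
      D.Pairwise I.Adj ∧ ∀ n : ℕ, eval I M u ^ n = evalFamily I M D fun i => a i ^ n := by
  suffices h : ∃ a : ∀ i, M i, ∀ x ∈ u, x.2.1 = a x.1 by
    obtain ⟨a, ha⟩ := h
    refine ⟨u.map Sigma.fst, a, List.pairwise_map.2 hu, fun n => ?_⟩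
    rw [eval_pow_of_pairwise hu, evalFamily, List.map_map]
    congr 1
    exact List.map_congr_left fun x hx => by simp [ha x hx]
  induction u with
  | nil => exact ⟨fun _ => 1, by simp⟩
  | cons x u ih =>
    obtain ⟨h1, h2⟩ := List.pairwise_cons.1 hu
    obtain ⟨a, ha⟩ := ih h2
    refine ⟨Function.update a x.1 x.2.1, ?_⟩
    simp only [List.mem_cons, forall_eq_or_imp, Function.update_self, true_and]
    intro y hy
    rw [Function.update_of_ne (h1 y hy).ne', ha y hy]

/-- Prefix a word by the nontrivial members of a family of elements of local monoids. -/
noncomputable def consFamily (D : List J) (b : ∀ i, M i) (w : List (BigLetter M)) :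
    List (BigLetter M) := D.foldr (fun i v => consLocal (b i) v) w

theorem eval_consFamily (D : List J) (b : ∀ i, M i) (w : List (BigLetter M)) :
    eval I M (consFamily D b w) = evalFamily I M D b * eval I M w := by
  induction D with
  | nil => simp [consFamily]
  | cons i D ih => rw [evalFamily_cons, mul_assoc, ← ih]; exact eval_consLocal _ _

theorem avail_consFamily {i : J} {D : List J} (h : ∀ j ∈ D, I.Adj j i) (b : ∀ i, M i)
    (w : List (BigLetter M)) : Avail I i (consFamily D b w) ↔ Avail I i w := by
  induction D with
  | nil => rfl
  | cons j D ih =>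
    exact (avail_consLocal (h j (by simp)) _ _).trans (ih fun k hk => h k (by simp [hk]))

theorem Reduced.consFamily {D : List J} (hD : D.Pairwise I.Adj) (b : ∀ i, M i)
    {w : List (BigLetter M)} (hw : Reduced I w) (h : ∀ i ∈ D, ¬ Avail I i w) :
    Reduced I (consFamily D b w) := by
  induction D with
  | nil => exact hw
  | cons i D ih =>
    obtain ⟨h1, h2⟩ := List.pairwise_cons.1 hD
    refine (ih h2 fun j hj => h j (by simp [hj])).consLocal _ fun hc => h i (by simp) ?_
    exact (avail_consFamily (fun j hj => (h1 j hj).symm) b w).1 hc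

/-- A letter that cannot be merged directly with its surroundings survives all reductions. -/
theorem exists_reduced_mem {b : BigLetter M} {s t : List (BigLetter M)} (hs : Reduced I s)
    (ht : Reduced I t) (hs' : ¬ Avail I b.1 s.reverse) (ht' : ¬ Avail I b.1 t) :
    ∃ w, Reduced I w ∧ b ∈ w ∧
      eval I M w = eval I M s * ofLocal I M b.1 b.2.1 * eval I M t := by
  induction hn : s.length + t.length using Nat.strong_induction_on generalizing s t with
  | _ n ih =>
    subst hn
    by_cases hr : Reduced I (s ++ b :: t)
    · exact ⟨_, hr, by simp, by simp [mul_assoc]⟩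
    obtain ⟨e, x, e', f, y, f', rfl, h2, h3, h4, h5⟩ :=
      not_reduced_append hs (show Reduced I (b :: t) from ⟨ht', ht⟩) hr
    -- If `f` is empty, then `y` is `b`, and `x` shows that the color of `b` is available at the end
    -- of `s`. Otherwise `x` and `y` merge across `b`, so their color is independent of that of `b`.
    -- The product is stored on the left, and the total length drops.
    cases f with
    | nil =>
      obtain ⟨rfl, rfl⟩ := List.cons.inj h2
      refine absurd (avail_iff.2 ⟨e'.reverse, x, e.reverse, by simp, h3, ?_⟩) hs'
      rw [← h3]
      simpa using h4
    | cons z f =>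
      rw [List.cons_append] at h2
      obtain ⟨rfl, rfl⟩ := List.cons.inj h2
      obtain ⟨i, x⟩ := x
      obtain ⟨j, y⟩ := y
      obtain rfl : i = j := h3
      have hbx : I.Adj b.1 i := h5 b (by simp)
      have hf : ∀ z ∈ f, I.Adj z.1 i := fun z hz => h5 z (by simp [hz])
      have es := TraceEq.move_last (x := ⟨i, x⟩) h4 e
      have et := TraceEq.move (x := ⟨i, y⟩) hf f'
      have hs1 : Reduced I (e ++ e' ++ [⟨i, x⟩]) := hs.congr es
      have ht1 := ht.congr et
      have hs2 : ¬ Avail I b.1 (e ++ e').reverse := fun hc => hs' <|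
        Avail.congr (w := ⟨i, x⟩ :: (e ++ e').reverse) (Or.inr ⟨hbx.symm, hc⟩)
          (by simpa using es.reverse.symm)
      have ht2 : ¬ Avail I b.1 (f ++ f') := fun hc => ht' <|
        Avail.congr (w := ⟨i, y⟩ :: (f ++ f')) (Or.inr ⟨hbx.symm, hc⟩) et.symm
      have heval : eval I M (e ++ ⟨i, x⟩ :: e') * ofLocal I M b.1 b.2.1 *
          eval I M (f ++ ⟨i, y⟩ :: f') = eval I M (e ++ e') * ofLocal I M i (x.1 * y.1) *
            ofLocal I M b.1 b.2.1 * eval I M (f ++ f') := by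
        rw [es.eval_eq, et.eval_eq, eval_append _ _ (e ++ e'), eval_cons, eval_cons, eval_nil,
          mul_one, map_mul]
        simp only [mul_assoc]
        rw [← mul_assoc (ofLocal I M b.1 b.2.1) (ofLocal I M i y.1),
          ofLocal_comm I M hbx b.2.1 y.1]
        simp only [mul_assoc]
      rw [heval]
      by_cases hxy : x.1 * y.1 = 1
      · obtain ⟨w, h6, h7, h8⟩ := ih ((e ++ e').length + (f ++ f').length)
          (by simp only [List.length_append, List.length_cons]; omega)
          hs1.of_append_left ht1.2 hs2 ht2 rfl
        exact ⟨w, h6, h7, by rw [h8, hxy, map_one, mul_one]⟩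
      · let c : BigLetter M := ⟨i, x.1 * y.1, hxy⟩
        obtain ⟨w, h6, h7, h8⟩ := ih ((e ++ e' ++ [c]).length + (f ++ f').length)
          (by simp only [List.length_append, List.length_cons, List.length_nil]; omega)
          (hs1.replace (x := ⟨i, x⟩) (y := c) rfl) ht1.2
          (by
            rw [List.reverse_append, List.reverse_singleton, List.singleton_append]
            rintro (hc | ⟨-, hc⟩)
            · exact hbx.ne hc.symm
            · exact hs2 hc) ht2 rfl
        exact ⟨w, h6, h7, by rw [h8, eval_append _ _ (e ++ e')]; simp [c]⟩

/-- The products `x p ^ n y`, for a product `p` of pairwise independent letters, can be written such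
that the local factors survive all reductions as long as they are nontrivial. -/
theorem exists_evalFamily_decomposition {u : List (BigLetter M)}
    (hu : u.Pairwise fun a b => I.Adj a.1 b.1) (g h : GraphProduct I M) :
    ∃ (D : List J) (x a y : ∀ i, M i) (s t : GraphProduct I M),
      (∀ n : ℕ, g * eval I M u ^ n * h = s * evalFamily I M D (fun i => x i * a i ^ n * y i) * t) ∧
      ∀ n : ℕ, ∀ i ∈ D, ∀ hi : x i * a i ^ n * y i ≠ 1, ∃ w, Reduced I w ∧
        ⟨i, x i * a i ^ n * y i, hi⟩ ∈ w ∧ eval I M w = g * eval I M u ^ n * h := by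
  obtain ⟨D, a, hD, ha⟩ := exists_evalFamily_pow hu
  -- The words `s` and `t`, the same for all `n`, are chosen with minimal total length. They are
  -- then reduced, and no letter with a color in `D` is available next to the family, since it could
  -- be absorbed into `x` or `y`.
  let P : ℕ → Prop := fun k => ∃ (s t : List (BigLetter M)) (x y : ∀ i, M i),
    s.length + t.length = k ∧ ∀ n : ℕ, g * eval I M u ^ n * h =
      eval I M s * evalFamily I M D (fun i => x i * a i ^ n * y i) * eval I M t
  have hP : ∃ k, P k := by
    obtain ⟨s, rfl⟩ := exists_eval_eq g
    obtain ⟨t, rfl⟩ := exists_eval_eq h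
    exact ⟨_, s, t, fun _ => 1, fun _ => 1, rfl, fun n => by simp [ha]⟩
  classical
  obtain ⟨s, t, x, y, hlen, hn⟩ := Nat.find_spec hP
  have hmin (s' t' : List (BigLetter M)) (x' y' : ∀ i, M i)
      (h1 : s'.length + t'.length < s.length + t.length) : ¬ ∀ n : ℕ, g * eval I M u ^ n * h =
      eval I M s' * evalFamily I M D (fun i => x' i * a i ^ n * y' i) * eval I M t' :=
    fun h2 => Nat.find_min hP (hlen ▸ h1) ⟨s', t', x', y', rfl, h2⟩
  have hs : Reduced I s := by
    by_contra hs
    obtain ⟨s', h1, h2⟩ := exists_shorter_of_not_reduced hs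
    exact hmin s' t x y (by omega) (by rw [h2]; exact hn)
  have ht : Reduced I t := by
    by_contra ht
    obtain ⟨t', h1, h2⟩ := exists_shorter_of_not_reduced ht
    exact hmin s t' x y (by omega) (by rw [h2]; exact hn)
  have hs' : ∀ i ∈ D, ¬ Avail I i s.reverse := by
    intro i hi hc
    obtain ⟨c, v, hv⟩ := hc.exists_traceEq_cons
    have hv := hv.reverse
    rw [List.reverse_reverse, List.reverse_cons] at hv
    refine hmin v.reverse t (Function.update x i (c.1 * x i)) y
      (by have := hv.length_eq; simp at this ⊢; omega) fun n => ?_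
    rw [hn, hv.eval_eq, eval_append, eval_cons, eval_nil, mul_one, mul_assoc (eval I M _),
      ofLocal_mul_evalFamily hD hi]
    congr 2
    refine evalFamily_congr fun j _ => ?_
    by_cases hj : j = i
    · subst hj; simp [mul_assoc]
    · simp [Function.update_of_ne hj]
  have ht' : ∀ i ∈ D, ¬ Avail I i t := by
    intro i hi hc
    obtain ⟨c, v, hv⟩ := hc.exists_traceEq_cons
    refine hmin s v x (Function.update y i (y i * c.1))
      (by have := hv.length_eq; simp at this ⊢; omega) fun n => ?_
    rw [hn, hv.eval_eq, eval_cons, ← mul_assoc, mul_assoc (eval I M s),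
      evalFamily_mul_ofLocal hD hi]
    congr 2
    refine evalFamily_congr fun j _ => ?_
    by_cases hj : j = i
    · subst hj; simp [mul_assoc]
    · simp [Function.update_of_ne hj]
  refine ⟨D, x, a, y, _, _, hn, fun n i hi hne => ?_⟩
  obtain ⟨D₁, D₂, rfl⟩ := List.append_of_mem hi
  set b : ∀ i, M i := fun i => x i * a i ^ n * y i
  have hperm : (i :: (D₁ ++ D₂)).Pairwise I.Adj :=
    (List.perm_middle.pairwise_iff fun h => h.symm).1 hD
  obtain ⟨h1, h2⟩ := List.pairwise_cons.1 hperm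
  have hmem : ∀ j ∈ D₁ ++ D₂, j ∈ D₁ ++ i :: D₂ := fun j hj => by
    simp only [List.mem_append, List.mem_cons] at hj ⊢; tauto
  obtain ⟨w, h3, h4, h5⟩ := exists_reduced_mem (b := ⟨i, b i, hne⟩)
    (t := consFamily (D₁ ++ D₂) b t) hs
    (ht.consFamily h2 b fun j hj => ht' j (hmem j hj)) (hs' i hi)
    (fun hc => ht' i hi ((avail_consFamily (fun j hj => (h1 j hj).symm) b t).1 hc))
  refine ⟨w, h3, h4, ?_⟩
  have hnb : g * eval I M u ^ n * h =
    eval I M s * evalFamily I M (D₁ ++ i :: D₂) b * eval I M t := hn n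
  rw [h5, hnb, eval_consFamily, evalFamily_append, evalFamily_append, evalFamily_cons]
  have hc := commute_evalFamily (fun j hj => h1 j (List.mem_append_left _ hj)) (b i) b
  simp only [mul_assoc]
  rw [← mul_assoc (evalFamily I M D₁ b) (ofLocal I M i (b i)), ← hc.eq]
  simp only [mul_assoc]

theorem finite_evalFamily (D : List J) {S : ∀ i, Set (M i)} (hS : ∀ i ∈ D, (S i).Finite) :
    {g | ∃ b : ∀ i, M i, (∀ i ∈ D, b i ∈ S i) ∧ g = evalFamily I M D b}.Finite := by
  induction D with
  | nil => exact (Set.finite_singleton 1).subset (by rintro g ⟨b, -, rfl⟩; simp)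
  | cons i D ih =>
    have h1 := (hS i (by simp)).image (ofLocal I M i)
    have h2 := ih fun j hj => hS j (by simp [hj])
    refine (Set.Finite.image2 (· * ·) h1 h2).subset ?_
    rintro g ⟨b, hb, rfl⟩
    exact ⟨_, ⟨b i, hb i (by simp), rfl⟩, _, ⟨b, fun j hj => hb j (by simp [hj]), rfl⟩,
      (evalFamily_cons ..).symm⟩

end Family

/-! ### Both statements of the theorem -/

section Main

variable {J : Type*} [LinearOrder J] {I : SimpleGraph J} {M : J → Type*} [∀ i, Monoid (M i)]
  {Γ : J → Type*} [∀ i, LinearOrder (Γ i)] {nf : ∀ i, M i → FreeMonoid (Γ i)}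

theorem expWord_le_globalNF (hnf : ∀ i m, m ≠ 1 → nf i m ≠ 1) {a : BigLetter M}
    {w : List (BigLetter M)} (hw : Reduced I w) (ha : a ∈ w) :
    expWord (nf a.1 a.2.1) ≤ expWord (globalNF I M nf (eval I M w)) := by
  obtain ⟨v, h1, h2, h3, h4⟩ := exists_globalNF_eq hnf (eval I M w)
  rw [h4]
  exact expWord_le_flatNF (((hw.traceEq_of_eval_eq h2 h3.symm).mem_iff).1 ha)

theorem starSet_mul {N : Type*} [Monoid N] (u x y v : N) :
    starSet u (x * y) v = insert (u * v) (starSet (u * x) (y * x) (y * v)) := by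
  have key (n : ℕ) : u * (x * y) ^ (n + 1) * v = u * x * (y * x) ^ n * (y * v) := by
    have : x * (y * x) ^ n = (x * y) ^ n * x := by
      induction n with
      | zero => simp
      | succ n ih => rw [pow_succ, ← mul_assoc, ih, pow_succ]; simp only [mul_assoc]
    rw [mul_assoc u x, this, pow_succ]
    simp only [mul_assoc]
  ext g
  simp only [starSet, Set.mem_range, Set.mem_insert_iff]
  constructor
  · rintro ⟨n, rfl⟩
    cases n with
    | zero => left; simp
    | succ n => right; exact ⟨n, (key n).symm⟩
  · rintro (rfl | ⟨n, rfl⟩)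
    · exact ⟨0, by simp⟩
    · exact ⟨n + 1, key n⟩

/-- It suffices to consider powers of products of pairwise independent letters and powers for which
the exponents of the normal forms tend to infinity. -/
theorem globalNF_starSet_induction {Q : Set (FreeMonoid (Σ i, Γ i)) → Prop}
    (hnf : ∀ i m, m ≠ 1 → nf i m ≠ 1) (hins : ∀ w L, Q L → Q (insert w L))
    (hpow : ∀ u p v : GraphProduct I M, (∀ K, ∃ n₀, ∀ n ≥ n₀,
      K ≤ expWord (globalNF I M nf (u * p ^ n * v))) → Q (globalNF I M nf '' starSet u p v))
    (hfam : ∀ (u p v : GraphProduct I M) (D : List J) (x a y : ∀ i, M i) (s t : GraphProduct I M),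
      (∀ n : ℕ, u * p ^ n * v = s * evalFamily I M D (fun i => x i * a i ^ n * y i) * t) →
      (∀ n : ℕ, ∀ i ∈ D, x i * a i ^ n * y i ≠ 1 → expWord (nf i (x i * a i ^ n * y i)) ≤
        expWord (globalNF I M nf (u * p ^ n * v))) → Q (globalNF I M nf '' starSet u p v))
    (u p v : GraphProduct I M) : Q (globalNF I M nf '' starSet u p v) := by
  induction p using cyclic_induction generalizing u v with
  | hrot x y ih =>
    rw [starSet_mul, Set.image_insert_eq]
    exact hins _ _ (ih _ _)
  | hbase l q h1 h2 h3 =>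
    by_cases hq : q = []
    · subst hq
      rw [eval_nil, mul_one]
      obtain ⟨D, x, a, y, s, t, h4, h5⟩ := exists_evalFamily_decomposition h1 u v
      refine hfam _ _ _ D x a y s t h4 fun n i hi hne => ?_
      obtain ⟨w, h6, h7, h8⟩ := h5 n i hi hne
      rw [← h8]
      exact expWord_le_globalNF hnf h6 h7
    · exact hpow _ _ _ (exists_le_expWord_globalNF hnf h1 h2 h3 hq u v)

theorem periodicallyNice_globalNF {π : ∀ i, FreeMonoid (Γ i) →* M i}
    (h : ∀ i, IsAdmissible (π i) (nf i)) (u p v : GraphProduct I M) :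
    PeriodicallyNice (globalNF I M nf '' starSet u p v) := by
  refine globalNF_starSet_induction (Q := PeriodicallyNice)
    (fun i => isNormalForm_ne_one (h i).1) (fun w L hL => hL.insert w) ?_ ?_ u p v
  · intro u p v hK
    rw [periodicallyNice_iff]
    intro _ n
    obtain ⟨n₀, hn₀⟩ := hK n
    exact ⟨_, ⟨_, ⟨n₀, rfl⟩, rfl⟩, hn₀ n₀ le_rfl⟩
  · intro u p v D x a y s t h1 h2
    rw [periodicallyNice_iff]
    intro hinf n
    -- If every local factor took finitely many values, so would the product.
    obtain ⟨i, hi, hi'⟩ : ∃ i ∈ D, (starSet (x i) (a i) (y i)).Infinite := by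
      by_contra! hfin
      refine hinf (Set.Finite.image _ (((finite_evalFamily (I := I) D
        (S := fun i => starSet (x i) (a i) (y i))
        fun i hi => hfin i hi).image fun g => s * g * t).subset ?_))
      rintro _ ⟨n, rfl⟩
      exact ⟨_, ⟨fun i => x i * a i ^ n * y i, fun i _ => ⟨n, rfl⟩, rfl⟩, (h1 n).symm⟩
    have hinj : Function.Injective (nf i) := Function.LeftInverse.injective (h i).1
    -- The normal form of `1` need not be empty. Exceeding its exponent ensures that the local
    -- element found is nontrivial, as `h2` requires.
    obtain ⟨_, ⟨_, ⟨k, rfl⟩, rfl⟩, hk⟩ := periodicallyNice_iff.1 ((h i).2 (x i) (a i) (y i))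
      (hi'.image hinj.injOn) (max n (expWord (nf i 1) + 1))
    refine ⟨_, ⟨_, ⟨k, rfl⟩, rfl⟩, (le_max_left _ _).trans (hk.trans (h2 k i hi fun h0 => ?_))⟩
    simp only [h0] at hk
    omega

theorem periodicallyPerfect_globalNF [∀ i, Finite (Γ i)] {π : ∀ i, FreeMonoid (Γ i) →* M i}
    (h : ∀ i, IsPerfectlyAdmissible (π i) (nf i)) (u p v : GraphProduct I M) :
    PeriodicallyPerfect (globalNF I M nf '' starSet u p v) := by
  refine globalNF_starSet_induction (Q := PeriodicallyPerfect)
    (fun i => isNormalForm_ne_one (h i).1) (fun w L hL => hL.insert w) ?_ ?_ u p v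
  · intro u p v hK n
    obtain ⟨n₀, hn₀⟩ := hK n
    -- Only finitely many exponents lie below `n₀`, so longer normal forms belong to exponents at
    -- least `n₀`.
    obtain ⟨N, hN⟩ := ((Set.finite_lt_nat n₀).image fun k =>
      (globalNF I M nf (u * p ^ k * v)).length).bddAbove
    refine ⟨N + 1, ?_⟩
    rintro _ ⟨_, ⟨k, rfl⟩, rfl⟩ hk
    refine hn₀ k (not_lt.1 fun hlt => ?_)
    have := hN ⟨k, hlt, rfl⟩
    simp only at this hk
    omega
  · intro u p v D x a y s t h1 h2 n
    choose N hN using fun i => (h i).2 (x i) (a i) (y i) (max n (expWord (nf i 1) + 1))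
    -- Over a finite alphabet only finitely many local elements have short normal forms. Hence a
    -- global normal form longer than `L` forces some local factor to have a long one.
    have hfin (i : J) : {m : M i | (nf i m).length < N i}.Finite := by
      have hinj : Function.Injective (nf i) := Function.LeftInverse.injective (h i).1
      exact Set.Finite.preimage hinj.injOn (List.finite_length_lt (Γ i) (N i))
    obtain ⟨L, hL⟩ := ((finite_evalFamily (I := I) D (S := fun i => {m | (nf i m).length < N i})
      fun i _ => hfin i).image fun g => (globalNF I M nf (s * g * t)).length).bddAbove
    refine ⟨L + 1, ?_⟩
    rintro _ ⟨_, ⟨k, rfl⟩, rfl⟩ hk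
    obtain ⟨i, hi, hik⟩ : ∃ i ∈ D, N i ≤ (nf i (x i * a i ^ k * y i)).length := by
      by_contra! hlt
      have := hL ⟨_, ⟨fun i => x i * a i ^ k * y i, hlt, rfl⟩, rfl⟩
      simp only [← h1] at this hk
      omega
    have hk' := hN i _ ⟨_, ⟨k, rfl⟩, rfl⟩ hik
    refine (le_max_left _ _).trans (hk'.trans (h2 k i hi fun h0 => ?_))
    simp only [h0] at hk'
    omega

end Main

end GraphProd

theorem theorem4p10 {J : Type*} [Finite J] [LinearOrder J] (I : SimpleGraph J)
    (M : J → Type*) [∀ i, Monoid (M i)]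
    (Γ : J → Type*) [∀ i, Finite (Γ i)] [∀ i, LinearOrder (Γ i)]
    (π : ∀ i, FreeMonoid (Γ i) →* M i) (nf : ∀ i, M i → FreeMonoid (Γ i)) :
    ((∀ i, GraphProd.IsAdmissible (π i) (nf i)) →
      GraphProd.IsAdmissible (GraphProd.globalPi I M π) (GraphProd.globalNF I M nf)) ∧
    ((∀ i, GraphProd.IsPerfectlyAdmissible (π i) (nf i)) →
      GraphProd.IsPerfectlyAdmissible (GraphProd.globalPi I M π) (GraphProd.globalNF I M nf)) :=
  ⟨fun h => ⟨GraphProd.isNormalForm_globalNF π fun i => (h i).1,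
      GraphProd.periodicallyNice_globalNF h⟩,
    fun h => ⟨GraphProd.isNormalForm_globalNF π fun i => (h i).1,
      GraphProd.periodicallyPerfect_globalNF h⟩⟩
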